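/- Let $d,n\in\mathbb N$, $n\ge 1$. For $\varepsilon>0$ let $V_1^\varepsilon\in C^4(\mathbb R^d)$ and $V_2\in C^2(\mathbb R^d)$ be non-negative functions, and let $V_1:\mathbb R^d\to\mathbb R$, $x^i_\varepsilon,x^i\in\mathbb R^d$ ($1\le i\le n$), be such that: 1. there are $\varepsilon_0,M>0$ with $|\partial^\alpha V_1^\varepsilon(y)|\le M e^{|y|^2}$ and $|\partial^\beta V_2(y)|\le Me^{|y|^2}$ for all $0<\varepsilon<\varepsilon_0$, $|\alpha|\le 4$, $|\beta|\le 2$, $y\in\mathbb R^d$; 2. for all small $\varepsilon>0$ the set of global minimizers of $V_1^\varepsilon$ is $\{x^1_\varepsilon,\dots,x^n_\varepsilon\}$, and $V_1^\varepsilon(x^i_\varepsilon)=0$ for all $i$; 3. $V_1^\varepsilon\to V_1$ pointwise as $\varepsilon\downarrow0$; the set of global minimizers of $V_1$ is $\mathcal E=\{x^1,\dots,x^n\}$ with $x^1,\dots,x^n$ distinct, and each Hessian $D^2V_1(x^i)$ is positive definite; 4. $x^i_\varepsilon\to x^i$ as $\varepsilon\downarrow0$ for each $i$; 5. there are $c_0,c_1,\varepsilon_0>0$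 with $V_1^\varepsilon(y)\ge -c_0+c_1|y|^2$ for all $0<\varepsilon<\varepsilon_0$, $y\in\mathbb R^d$. Let $\mu_\varepsilon(dy)=Z_\varepsilon^{-1}\exp\big(-\tfrac1\varepsilon V_1^\varepsilon(y)-V_2(y)\big)\,dy$ with $Z_\varepsilon$ the normalization constant, and let $\boldsymbol\beta=(\bar\beta^1,\dots,\bar\beta^n)$, $\bar\beta^i=\beta^i/\sum_j\beta^j$, where $\beta^i=(\det D^2V_1(x^i))^{-1/2}e^{-V_2(x^i)}$. Let $\xi_1,\xi_2>0$ satisfy $\xi_1\le\min_i\bar\beta^i$ and, for all small $\varepsilon>0$, $\xi_2\le |x^i_\varepsilon-x^j_\varepsilon|$ for all $i\ne j$ (the latter holds in particular if $\xi_2<\min_{i\neq j}|x^i-x^j|$). Let $S_{\boldsymbol\xi}$ be the set of $(\boldsymbol\alpha,\mathbf m)\in\mathbb R^n\times(\mathbb R^d)^n$ with $\sum_i\alpha^i=1$, $\alpha^i\ge\xi_1$ for all $i$, and $|m^i-m^j|\ge\xi_2$ for all $i\neq j$. For $(\boldsymbol\alpha,\mathbf m)\in\mathbb R^n\times(\mathbb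 R^d)^n$ and an $n$-tuple $\boldsymbol\Sigma$ of positive semi-definite $d\times d$ matrices put $$G_\varepsilon(\boldsymbol\alpha,\mathbf m,\boldsymbol\Sigma)=D_{\mathrm{KL}}\Big(\sum_{i=1}^n\alpha^iN(m^i,\varepsilon\Sigma^i)\,\Big\|\,\mu_\varepsilon\Big)\ \text{ if }(\boldsymbol\alpha,\mathbf m)\in S_{\boldsymbol\xi},\qquad +\infty\text{ otherwise},$$ $$G(\boldsymbol\alpha,\mathbf m,\boldsymbol\Sigma)=\sum_{i=1}^n\alpha^iD_{\mathrm{KL}}\big(N(m^i,\Sigma^i)\,\big\|\,N(m^i,D^2V_1(m^i)^{-1})\big)+D_{\mathrm{KL}}(\boldsymbol\alpha\,\|\,\boldsymbol\beta)$$ if $(\boldsymbol\alpha,\mathbf m)\in S_{\boldsymbol\xi}$ and all $m^i\in\mathcal E$, and $G=+\infty$ otherwise. For all small $\varepsilon>0$ let $(\boldsymbol\alpha_\varepsilon,\mathbf m_\varepsilon,\boldsymbol\Sigma_\varepsilon)$ be a minimizer of $G_\varepsilon$, and put $(\overline{\boldsymbol\alpha},\overline{\mathbf m},\overline{\boldsymbol\Sigma})=\big(\boldsymbol\beta,(x^i)_i,(D^2V_1(x^i)^{-1})_i\big)$.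 Then: * every sequence $\varepsilon_j\downarrow0$ has a subsequence $(\varepsilon_{j_k})$ and a permutation $\sigma$ of $\{1,\dots,n\}$ such that, after relabelling the $n$ mixture components by $\sigma$, $(\boldsymbol\alpha_{\varepsilon_{j_k}},\mathbf m_{\varepsilon_{j_k}},\boldsymbol\Sigma_{\varepsilon_{j_k}})\to(\overline{\boldsymbol\alpha},\overline{\mathbf m},\overline{\boldsymbol\Sigma})$, and $G_{\varepsilon_{j_k}}(\boldsymbol\alpha_{\varepsilon_{j_k}},\mathbf m_{\varepsilon_{j_k}},\boldsymbol\Sigma_{\varepsilon_{j_k}})\to G(\overline{\boldsymbol\alpha},\overline{\mathbf m},\overline{\boldsymbol\Sigma})$; * $(\overline{\boldsymbol\alpha},\overline{\mathbf m},\overline{\boldsymbol\Sigma})$ is a minimizer of $G$, and $G(\overline{\boldsymbol\alpha},\overline{\mathbf m},\overline{\boldsymbol\Sigma})=0$; * consequently $G_\varepsilon(\boldsymbol\alpha_\varepsilon,\mathbf m_\varepsilon,\boldsymbol\Sigma_\varepsilon)\to0$ as $\varepsilon\downarrow0$: the Kullback–Leibler divergence of the best Gaussian mixture tends to zero. -/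

import Mathlib

open MeasureTheory Filter Topology
open scoped ENNReal

namespace GaussMix

/-- The Euclidean space `ℝ^d`. -/
abbrev E (d : ℕ) : Type := EuclideanSpace ℝ (Fin d)

/-- The iterated partial derivative `∂_{j 0} ⋯ ∂_{j (k-1)} f (x)`. -/
noncomputable def partialDeriv {d k : ℕ} (j : Fin k → Fin d) (f : E d → ℝ) (x : E d) : ℝ :=
  iteratedFDeriv ℝ k f x (fun l => EuclideanSpace.single (j l) (1 : ℝ))

/-- The Hessian matrix `D² f (x)`. -/
noncomputable def hessian {d : ℕ} (f : E d → ℝ) (x : E d) : Matrix (Fin d) (Fin d) ℝ :=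
  Matrix.of fun i j => partialDeriv ![i, j] f x

/-- The standing assumptions on the potentials: `V1e ε` is `V₁^ε`, `V1` is the pointwise limit
`V₁`, `xe ε i` is the minimiser `x^i_ε` of `V₁^ε`, and `x i` is the minimiser `x^i` of `V₁`. -/
structure Assumptions {d n : ℕ} (V1e : ℝ → E d → ℝ) (V1 V2 : E d → ℝ)
    (xe : ℝ → Fin n → E d) (x : Fin n → E d) : Prop where
  V1e_smooth : ∀ ε > 0, ContDiff ℝ 4 (V1e ε)
  V1e_nonneg : ∀ ε > 0, ∀ y, 0 ≤ V1e ε y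
  V2_smooth : ContDiff ℝ 2 V2
  V2_nonneg : ∀ y, 0 ≤ V2 y
  growth : ∃ ε₀ > (0 : ℝ), ∃ M > (0 : ℝ), ∀ ε, 0 < ε → ε < ε₀ → ∀ y : E d,
    (∀ k ≤ 4, ∀ j : Fin k → Fin d,
      |partialDeriv j (V1e ε) y| ≤ M * Real.exp (‖y‖ ^ 2)) ∧
    (∀ k ≤ 2, ∀ j : Fin k → Fin d,
      |partialDeriv j V2 y| ≤ M * Real.exp (‖y‖ ^ 2))
  n_pos : 0 < n
  minimisers_eps : ∀ᶠ ε in 𝓝[>] (0 : ℝ),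
    {y | ∀ z, V1e ε y ≤ V1e ε z} = Set.range (xe ε) ∧ ∀ i, V1e ε (xe ε i) = 0
  pointwise_limit : ∀ y, Tendsto (fun ε => V1e ε y) (𝓝[>] 0) (𝓝 (V1 y))
  minimisers : {y | ∀ z, V1 y ≤ V1 z} = Set.range x
  minimisers_distinct : Function.Injective x
  hessian_posDef : ∀ i, (hessian V1 (x i)).PosDef
  minimisers_tendsto : ∀ i, Tendsto (fun ε => xe ε i) (𝓝[>] 0) (𝓝 (x i))
  coercive : ∃ c₀ > (0 : ℝ), ∃ c₁ > (0 : ℝ), ∃ ε₀ > (0 : ℝ), ∀ ε, 0 < ε → ε < ε₀ →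
    ∀ y : E d, -c₀ + c₁ * ‖y‖ ^ 2 ≤ V1e ε y

/-- The normalisation constant `∫ exp (-V₁ / ε - V₂)`. -/
noncomputable def normConst {d : ℕ} (ε : ℝ) (V1 V2 : E d → ℝ) : ℝ :=
  ∫ y, Real.exp (-(1 / ε) * V1 y - V2 y)

/-- The target measure `Z⁻¹ exp (-V₁ / ε - V₂) dx`. -/
noncomputable def target {d : ℕ} (ε : ℝ) (V1 V2 : E d → ℝ) : Measure (E d) :=
  volume.withDensity fun y =>
    ENNReal.ofReal (Real.exp (-(1 / ε) * V1 y - V2 y) / normConst ε V1 V2)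

/-- Triples `(α, m, Σ)` of `n` weights, means and matrices, with the product topology. -/
abbrev Params (n d : ℕ) : Type :=
  (Fin n → ℝ) × (Fin n → E d) × (Fin n → Matrix (Fin d) (Fin d) ℝ)

/-- The domain of the functionals: all the covariance matrices are positive semi-definite. -/
def domain (n d : ℕ) : Set (Params n d) :=
  {p | ∀ i, (p.2.2 i).PosSemidef}

/-- Relabelling of the `n` components by a permutation. -/
def relabel {n d : ℕ} (σ : Equiv.Perm (Fin n)) (p : Params n d) : Params n d :=
  (p.1 ∘ σ, p.2.1 ∘ σ, p.2.2 ∘ σ)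

/-- The scaled Gaussian mixture `∑ i, α^i N(m^i, ε Σ^i)`. -/
noncomputable def mixture {n d : ℕ} (ε : ℝ) (p : Params n d) : Measure (E d) :=
  ∑ i, ENNReal.ofReal (p.1 i) • ProbabilityTheory.multivariateGaussian (p.2.1 i) (ε • p.2.2 i)

/-- The admissible weights and means: `α` is in the unit simplex with all entries at least `ξ₁`,
and the means are at mutual distance at least `ξ₂`. -/
def admissible (n d : ℕ) (ξ₁ ξ₂ : ℝ) : Set ((Fin n → ℝ) × (Fin n → E d)) :=
  {q | q.1 ∈ stdSimplex ℝ (Fin n) ∧ (∀ i, ξ₁ ≤ q.1 i) ∧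
    ∀ i j, i ≠ j → ξ₂ ≤ ‖q.2 i - q.2 j‖}

open scoped Classical in
/-- The functional `G_ε`. -/
noncomputable def Geps {n d : ℕ} (ξ₁ ξ₂ ε : ℝ) (V1 V2 : E d → ℝ) (p : Params n d) : ℝ≥0∞ :=
  if (p.1, p.2.1) ∈ admissible n d ξ₁ ξ₂ then
    InformationTheory.klDiv (mixture ε p) (target ε V1 V2)
  else ∞

/-- The unnormalised weight `(det D² V₁(x^i))^(-1/2) exp (-V₂(x^i))`. -/
noncomputable def rawWeight {n d : ℕ} (V1 V2 : E d → ℝ) (x : Fin n → E d) (i : Fin n) : ℝ :=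
  (√(hessian V1 (x i)).det)⁻¹ * Real.exp (-V2 (x i))

/-- The normalised weights `β`. -/
noncomputable def weight {n d : ℕ} (V1 V2 : E d → ℝ) (x : Fin n → E d) (i : Fin n) : ℝ :=
  rawWeight V1 V2 x i / ∑ j, rawWeight V1 V2 x j

/-- The measure on `{1, …, n}` with weights `α`. -/
noncomputable def discreteMeasure {n : ℕ} (α : Fin n → ℝ) : Measure (Fin n) :=
  ∑ i, ENNReal.ofReal (α i) • Measure.dirac i

open scoped Classical in
/-- The limit functional `G`. -/
noncomputable def Glim {n d : ℕ} (ξ₁ ξ₂ : ℝ) (V1 V2 : E d → ℝ) (x : Fin n → E d)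
    (p : Params n d) : ℝ≥0∞ :=
  if (p.1, p.2.1) ∈ admissible n d ξ₁ ξ₂ ∧ ∀ i, p.2.1 i ∈ Set.range x then
    (∑ i, ENNReal.ofReal (p.1 i) *
      InformationTheory.klDiv
        (ProbabilityTheory.multivariateGaussian (p.2.1 i) (p.2.2 i))
        (ProbabilityTheory.multivariateGaussian (p.2.1 i) (hessian V1 (p.2.1 i))⁻¹)) +
      InformationTheory.klDiv (discreteMeasure p.1) (discreteMeasure (weight V1 V2 x))
  else ∞

/-- `p` is a minimiser of `J` over the triples with positive semi-definite matrices. -/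
def IsMinimiser {n d : ℕ} (J : Params n d → ℝ≥0∞) (p : Params n d) : Prop :=
  p ∈ domain n d ∧ IsMinOn J (domain n d) p

/-- The triple `(β, (x^i), (D² V₁(x^i)⁻¹))`. -/
noncomputable def limitParams {n d : ℕ} (V1 V2 : E d → ℝ) (x : Fin n → E d) : Params n d :=
  (weight V1 V2 x, x, fun i => (hessian V1 (x i))⁻¹)

end GaussMix

set_option maxSynthPendingDepth 3

namespace GaussMix

/-! ### Taylor bounds, and convergence of derivatives under pointwise limits -/

section Calculus

variable {X F : Type*} [NormedAddCommGroup X] [NormedSpace ℝ X]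
  [NormedAddCommGroup F] [NormedSpace ℝ F]

/-! Since Kullback–Leibler divergence is non-negative, one good competitor decides the limit of the
minimal values; no lower bound of Γ-convergence type is needed. The competitor `recovery` is the
mixture with weights β, means x^i_ε and covariances ε H_i⁻¹, H_i = D²V₁(x^i). Its divergence from
μ_ε is Σ_i β_i I_i(ε) + log(Z_ε / ε^(d/2)), where I_i(ε) integrates the logarithm of the rescaled
mixture density plus V₁^ε/ε + V₂ over the i-th component. In the variable y = x^i_ε + √ε z this
integrand tends to a constant, -log S, the same for all i and z: that is what the choice of β
achieves (`weight_mul_gaussDensity`). Here S = Σ_j ∫ exp(-z·H_j z/2 - V₂(x^j)) dz. Laplace's method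
bounds Z_ε / ε^(d/2) by a quantity with limit at most S, so the divergence tends to 0
(`tendsto_klDiv_recovery`).

Domination comes from two uniform estimates. The growth exp(|y|²) becomes exp(2ε|z|²) after
rescaling, which Fernique's theorem absorbs; and V₁^ε is at least a multiple of the squared distance
to its set of minimisers (`exists_quadratic_lower_bound`), which controls Z_ε.

By minimality the divergence of the optimal mixture also tends to 0. A Pinsker type inequality then
makes it merge in total variation with μ_ε, hence with the recovery mixture, and this determines its
parameters (`exists_perm_tendsto`). Weights at least ξ₁ force each component to charge a ball of
radius R√ε around some x^j_ε, which bounds its covariance and rescaled mean. Means at distance at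
least ξ₂ force different components to choose different minimisers. Finally, characters at scale √ε,
cut off near one minimiser, identify the weight and the covariance of its component. -/

theorem norm_iteratedFDeriv_le_of_partialDeriv {d k : ℕ} {f : E d → ℝ} {y : E d} {B : ℝ}
    (h : ∀ j : Fin k → Fin d, |partialDeriv j f y| ≤ B) (hB : 0 ≤ B) :
    ‖iteratedFDeriv ℝ k f y‖ ≤ (d : ℝ) ^ k * B := by
  refine ContinuousMultilinearMap.opNorm_le_bound (by positivity) fun v => ?_
  have hv : v = fun l => ∑ j : Fin d, (v l j) • EuclideanSpace.single j (1 : ℝ) := by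
    funext l
    ext a
    simp [Finset.sum_apply, Pi.single_apply]
  have hcoord : ∀ l (j : Fin d), |v l j| ≤ ‖v l‖ := fun l j => by
    simpa using PiLp.norm_apply_le (v l) j
  calc ‖iteratedFDeriv ℝ k f y v‖
      = ‖∑ r : Fin k → Fin d, (∏ l, v l (r l)) * partialDeriv r f y‖ := by
        conv_lhs => rw [hv]
        rw [ContinuousMultilinearMap.map_sum]
        simp_rw [ContinuousMultilinearMap.map_smul_univ]
        rfl
    _ ≤ ∑ r : Fin k → Fin d, ‖(∏ l, v l (r l)) * partialDeriv r f y‖ := norm_sum_le _ _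
    _ ≤ ∑ r : Fin k → Fin d, (∏ l, ‖v l‖) * B := by
        refine Finset.sum_le_sum fun r _ => ?_
        rw [norm_mul, Real.norm_eq_abs, Real.norm_eq_abs, Finset.abs_prod]
        refine mul_le_mul (Finset.prod_le_prod (fun _ _ => abs_nonneg _) fun l _ => hcoord l _)
          (h r) (abs_nonneg _) (Finset.prod_nonneg fun _ _ => norm_nonneg _)
    _ = (d : ℝ) ^ k * B * ∏ l, ‖v l‖ := by
        simp
        ring

/-- The derivative varies by at most `L * ‖h‖` on the ball of radius `‖h‖`, so the mean value
inequality applies; the factor 1/2 is given up. -/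
theorem norm_taylor_one_le {f : X → F} {y : X} {r L : ℝ} (hf : Differentiable ℝ f)
    (hf' : Differentiable ℝ (fderiv ℝ f))
    (hL : ∀ z ∈ Metric.closedBall y r, ‖fderiv ℝ (fderiv ℝ f) z‖ ≤ L) {h : X} (hh : ‖h‖ ≤ r) :
    ‖f (y + h) - f y - fderiv ℝ f y h‖ ≤ L * ‖h‖ ^ 2 := by
  have hsub : Metric.closedBall y ‖h‖ ⊆ Metric.closedBall y r :=
    Metric.closedBall_subset_closedBall hh
  have hy : y ∈ Metric.closedBall y ‖h‖ := Metric.mem_closedBall_self (norm_nonneg _)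
  have hL0 : 0 ≤ L := le_trans (norm_nonneg _) (hL y (hsub hy))
  have hyh : y + h ∈ Metric.closedBall y ‖h‖ := by simp
  have h1 : ∀ z ∈ Metric.closedBall y ‖h‖, ‖fderiv ℝ f z - fderiv ℝ f y‖ ≤ L * ‖h‖ := by
    intro z hz
    have := (convex_closedBall y ‖h‖).norm_image_sub_le_of_norm_fderiv_le
      (fun w _ => hf' w) (fun w hw => hL w (hsub hw)) hy hz
    refine this.trans (mul_le_mul_of_nonneg_left ?_ hL0)
    simpa [dist_eq_norm] using hz
  have := (convex_closedBall y ‖h‖).norm_image_sub_le_of_norm_fderiv_le' (fun w _ => hf w) h1 hy hyh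
  simpa [sq, mul_assoc] using this

theorem norm_taylor_two_le {f : X → F} (hf : ContDiff ℝ 3 f) {y : X} {r L : ℝ}
    (hL : ∀ z ∈ Metric.closedBall y r, ‖fderiv ℝ (fderiv ℝ (fderiv ℝ f)) z‖ ≤ L) {h : X}
    (hh : ‖h‖ ≤ r) :
    ‖f (y + h) - f y - fderiv ℝ f y h - (1 / 2 : ℝ) • fderiv ℝ (fderiv ℝ f) y h h‖
      ≤ L * ‖h‖ ^ 3 := by
  have hf1 : ContDiff ℝ 2 (fderiv ℝ f) := hf.fderiv_right (by norm_num)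
  have hf2 : ContDiff ℝ 1 (fderiv ℝ (fderiv ℝ f)) := hf1.fderiv_right (by norm_num)
  have hy : y ∈ Metric.closedBall y ‖h‖ := Metric.mem_closedBall_self (norm_nonneg _)
  have hyh : y + h ∈ Metric.closedBall y ‖h‖ := by simp
  have hL0 : 0 ≤ L := le_trans (norm_nonneg _)
    (hL y (Metric.mem_closedBall_self ((norm_nonneg _).trans hh)))
  set B := fderiv ℝ (fderiv ℝ f) y with hB
  -- Symmetry makes `B (z - y)` the derivative of half the quadratic form, which reduces the claim
  -- to the first order bound for `fderiv ℝ f`.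
  have hsymm : ∀ a b, B a b = B b a := by
    have := (hf.contDiffAt (x := y)).isSymmSndFDerivAt
      (by simpa using (by exact_mod_cast (by norm_num : (2 : ℕ) ≤ 3)))
    exact fun a b => this a b
  have hder : ∀ z, HasFDerivAt (fun z => f z - (1 / 2 : ℝ) • B (z - y) (z - y))
      (fderiv ℝ f z - B (z - y)) z := by
    intro z
    have hid : HasFDerivAt (fun z : X => z - y) (ContinuousLinearMap.id ℝ X) z :=
      (hasFDerivAt_id z).sub_const y
    have h2 := (B.isBoundedBilinearMap.hasFDerivAt (z - y, z - y)).comp z (hid.prodMk hid)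
    have h3 := ((hf.differentiable (by norm_num)) z).hasFDerivAt.sub (h2.const_smul (1 / 2 : ℝ))
    refine h3.congr_fderiv ?_
    ext a
    simp [hsymm a (z - y), ← add_smul]
    norm_num
  have h1 : ∀ z ∈ Metric.closedBall y ‖h‖,
      ‖fderiv ℝ f z - B (z - y) - fderiv ℝ f y‖ ≤ L * ‖h‖ ^ 2 := by
    intro z hz
    have hz' : ‖z - y‖ ≤ ‖h‖ := by simpa [dist_eq_norm] using hz
    have := norm_taylor_one_le (hf1.differentiable (by norm_num))
      (hf2.differentiable (by norm_num)) hL (hz'.trans hh)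
    rw [add_sub_cancel] at this
    rw [sub_right_comm]
    exact this.trans (by gcongr)
  have := (convex_closedBall y ‖h‖).norm_image_sub_le_of_norm_hasFDerivWithin_le'
    (fun z _ => (hder z).hasFDerivWithinAt) h1 hy hyh
  simp only [add_sub_cancel_left, sub_self, map_zero, smul_zero, sub_zero] at this
  calc _ = ‖f (y + h) - (1 / 2 : ℝ) • (B h) h - f y - (fderiv ℝ f y) h‖ := by
        congr 1; abel
    _ ≤ _ := this
    _ = _ := by ring

/-- Pointwise limits of functions with a uniform second order Taylor bound are differentiable, and
the derivatives converge. -/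
theorem hasFDerivAt_and_tendsto_fderiv [FiniteDimensional ℝ X] [FiniteDimensional ℝ F] {ι : Type*}
    {l : Filter ι} [NeBot l] {f : ι → X → F} {g : X → F} {y : X} {r L B : ℝ} (hr : 0 < r)
    (hB : ∀ᶠ i in l, ‖fderiv ℝ (f i) y‖ ≤ B)
    (hT : ∀ᶠ i in l, ∀ h, ‖h‖ < r → ‖f i (y + h) - f i y - fderiv ℝ (f i) y h‖ ≤ L * ‖h‖ ^ 2)
    (hlim : ∀ z, Tendsto (fun i => f i z) l (𝓝 (g z))) :
    HasFDerivAt g (fderiv ℝ g y) y ∧ Tendsto (fun i => fderiv ℝ (f i) y) l (𝓝 (fderiv ℝ g y)) := by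
  have : ProperSpace (X →L[ℝ] F) := FiniteDimensional.proper ℝ _
  -- The derivatives lie in a compact ball, so they converge along every ultrafilter. The Taylor
  -- bound passes to the limit and shows that this limit is the derivative of `g`; being the same
  -- for all ultrafilters, it is the limit along `l`.
  have key : ∀ U : Ultrafilter ι, ↑U ≤ l → ∃ D : X →L[ℝ] F, HasFDerivAt g D y ∧
      Tendsto (fun i => fderiv ℝ (f i) y) U (𝓝 D) := by
    intro U hU
    obtain ⟨D, -, hD⟩ := (isCompact_closedBall (0 : X →L[ℝ] F) B).ultrafilter_le_nhds
      (U.map fun i => fderiv ℝ (f i) y)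
      (by
        rw [le_principal_iff]
        have hUB : ∀ᶠ i in (U : Filter ι), ‖fderiv ℝ (f i) y‖ ≤ B := hU hB
        change ∀ᶠ i in (U : Filter ι), fderiv ℝ (f i) y ∈ Metric.closedBall 0 B
        simpa using hUB)
    have hD' : Tendsto (fun i => fderiv ℝ (f i) y) U (𝓝 D) := hD
    refine ⟨D, ?_, hD'⟩
    have hbound : ∀ h, ‖h‖ < r → ‖g (y + h) - g y - D h‖ ≤ L * ‖h‖ ^ 2 := by
      intro h hh
      have hev : Tendsto (fun i => fderiv ℝ (f i) y h) U (𝓝 (D h)) :=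
        ((ContinuousLinearMap.apply ℝ F h).continuous.tendsto D).comp hD'
      have ht := ((((hlim (y + h)).mono_left hU).sub ((hlim y).mono_left hU)).sub hev).norm
      exact le_of_tendsto ht (by filter_upwards [hU hT] with i hi using hi h hh)
    rw [hasFDerivAt_iff_isLittleO_nhds_zero]
    have hO : (fun h => g (y + h) - g y - D h) =O[𝓝 0] fun h : X => ‖h‖ ^ 2 := by
      refine Asymptotics.IsBigO.of_bound L ?_
      filter_upwards [Metric.ball_mem_nhds (0 : X) hr] with h hh
      simpa using hbound h (by simpa using hh)
    refine hO.trans_isLittleO ?_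
    simpa using (Asymptotics.isLittleO_norm_pow_id (E' := X) one_lt_two)
  have key' : ∀ U : Ultrafilter ι, ↑U ≤ l → HasFDerivAt g (fderiv ℝ g y) y ∧
      Tendsto (fun i => fderiv ℝ (f i) y) U (𝓝 (fderiv ℝ g y)) := by
    intro U hU
    obtain ⟨D, hD, hD'⟩ := key U hU
    rw [hD.fderiv]
    exact ⟨hD, hD'⟩
  refine ⟨(key' (Ultrafilter.of l) (Ultrafilter.of_le l)).1, ?_⟩
  rw [tendsto_iff_ultrafilter]
  exact fun U hU => (key' U hU).2

end Calculus

end GaussMix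

/-! ### Hessian forms and the expansion of the potentials at their minimisers -/

namespace GaussMix

open Matrix in
/-- The quadratic form `z ↦ z · H z`. -/
noncomputable def quadForm {d : ℕ} (H : Matrix (Fin d) (Fin d) ℝ) (z : E d) : ℝ :=
  z.ofLp ⬝ᵥ H *ᵥ z.ofLp

theorem continuous_quadForm {d : ℕ} (H : Matrix (Fin d) (Fin d) ℝ) :
    Continuous (quadForm H) := by
  unfold quadForm
  fun_prop

theorem quadForm_smul {d : ℕ} (H : Matrix (Fin d) (Fin d) ℝ) (t : ℝ) (z : E d) :
    quadForm H (t • z) = t ^ 2 * quadForm H z := by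
  simp [quadForm, Matrix.mulVec_smul]
  ring

theorem quadForm_nonneg {d : ℕ} {H : Matrix (Fin d) (Fin d) ℝ} (hH : H.PosSemidef) (z : E d) :
    0 ≤ quadForm H z := by
  simpa [quadForm] using hH.dotProduct_mulVec_nonneg z.ofLp

theorem quadForm_pos {d : ℕ} {H : Matrix (Fin d) (Fin d) ℝ} (hH : H.PosDef) {z : E d}
    (hz : z ≠ 0) : 0 < quadForm H z := by
  have : z.ofLp ≠ 0 := by simpa using hz
  simpa [quadForm] using hH.dotProduct_mulVec_pos this

theorem exists_pos_le_quadForm {d : ℕ} {H : Matrix (Fin d) (Fin d) ℝ} (hH : H.PosDef) :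
    ∃ c > 0, ∀ z, c * ‖z‖ ^ 2 ≤ quadForm H z := by
  -- The unit sphere is empty in dimension zero.
  rcases (Metric.sphere (0 : E d) 1).eq_empty_or_nonempty with he | hne
  · refine ⟨1, one_pos, fun z => ?_⟩
    have hz : z = 0 := by
      by_contra hz
      have : ‖z‖⁻¹ • z ∈ Metric.sphere (0 : E d) 1 := by
        simp [norm_smul, hz]
      simp [he] at this
    simp [hz, quadForm]
  · obtain ⟨w, hw, hmin⟩ := (isCompact_sphere (0 : E d) 1).exists_isMinOn hne
      (continuous_quadForm H).continuousOn
    have hw0 : w ≠ 0 := by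
      rintro rfl
      simp at hw
    refine ⟨quadForm H w, quadForm_pos hH hw0, fun z => ?_⟩
    by_cases hz : z = 0
    · simp [hz, quadForm]
    have hz' : 0 < ‖z‖ := norm_pos_iff.2 hz
    have : quadForm H w ≤ quadForm H (‖z‖⁻¹ • z) := hmin (by simp [norm_smul, hz])
    rw [quadForm_smul, inv_pow, inv_mul_eq_div, le_div_iff₀ (by positivity)] at this
    exact this

theorem fderiv_fderiv_eq_quadForm {d : ℕ} (f : E d → ℝ) (y z : E d) :
    fderiv ℝ (fderiv ℝ f) y z z = quadForm (hessian f y) z := by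
  have hz : z = ∑ j : Fin d, z j • EuclideanSpace.single j (1 : ℝ) := by
    ext a
    simp [Finset.sum_apply, Pi.single_apply]
  conv_lhs => rw [hz]
  simp only [quadForm, hessian, partialDeriv, dotProduct, Matrix.mulVec, map_sum, map_smul,
    _root_.sum_apply, _root_.smul_apply, smul_eq_mul, Matrix.of_apply,
    iteratedFDeriv_two_apply, Finset.mul_sum]
  rw [Finset.sum_comm]
  refine Finset.sum_congr rfl fun i _ => Finset.sum_congr rfl fun j _ => ?_
  simp
  ring

namespace Assumptions

variable {d n : ℕ} {V1e : ℝ → E d → ℝ} {V1 V2 : E d → ℝ} {xe : ℝ → Fin n → E d} {x : Fin n → E d}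

theorem exists_norm_iteratedFDeriv_le (hV : Assumptions V1e V1 V2 xe x) :
    ∃ C > 0, ∀ᶠ ε in 𝓝[>] (0 : ℝ), ∀ y, ∀ k ≤ 4,
      ‖iteratedFDeriv ℝ k (V1e ε) y‖ ≤ C * Real.exp (‖y‖ ^ 2) := by
  obtain ⟨ε₀, hε₀, M, hM, h⟩ := hV.growth
  -- This constant dominates `d ^ k` for all `k ≤ 4` at once, even for `d = 0`.
  refine ⟨(d + 1) ^ 4 * M, by positivity, ?_⟩
  filter_upwards [Ioo_mem_nhdsGT hε₀] with ε hε y k hk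
  refine (norm_iteratedFDeriv_le_of_partialDeriv ((h ε hε.1 hε.2 y).1 k hk)
    (by positivity)).trans ?_
  rw [mul_assoc]
  gcongr
  calc (d : ℝ) ^ k ≤ (d + 1) ^ k := by gcongr; linarith
    _ ≤ (d + 1) ^ 4 := pow_le_pow_right₀ (by simp) hk

/-- On every ball, the first three derivatives of `V₁^ε` are bounded, uniformly in `ε`. -/
theorem exists_norm_fderiv_le (hV : Assumptions V1e V1 V2 xe x) :
    ∃ C > 0, ∀ᶠ ε in 𝓝[>] (0 : ℝ), ContDiff ℝ 4 (V1e ε) ∧ ∀ R, ∀ y : E d, ‖y‖ ≤ R →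
      ‖fderiv ℝ (V1e ε) y‖ ≤ C * Real.exp (R ^ 2) ∧
      ‖fderiv ℝ (fderiv ℝ (V1e ε)) y‖ ≤ C * Real.exp (R ^ 2) ∧
      ‖fderiv ℝ (fderiv ℝ (fderiv ℝ (V1e ε))) y‖ ≤ C * Real.exp (R ^ 2) := by
  obtain ⟨C, hC, h⟩ := hV.exists_norm_iteratedFDeriv_le
  refine ⟨C, hC, ?_⟩
  filter_upwards [h, self_mem_nhdsWithin] with ε hε hpos
  refine ⟨hV.V1e_smooth ε hpos, fun R y hy => ?_⟩
  have hle : C * Real.exp (‖y‖ ^ 2) ≤ C * Real.exp (R ^ 2) := by gcongr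
  have h1 := (hε y 1 (by norm_num)).trans hle
  have h2 := (hε y 2 (by norm_num)).trans hle
  have h3 := (hε y 3 (by norm_num)).trans hle
  rw [← zero_add 1, ← norm_iteratedFDeriv_fderiv, norm_iteratedFDeriv_zero] at h1
  rw [← one_add_one_eq_two, ← norm_iteratedFDeriv_fderiv, ← zero_add 1,
    ← norm_iteratedFDeriv_fderiv, norm_iteratedFDeriv_zero] at h2
  rw [← two_add_one_eq_three, ← norm_iteratedFDeriv_fderiv, ← one_add_one_eq_two,
    ← norm_iteratedFDeriv_fderiv, ← zero_add 1, ← norm_iteratedFDeriv_fderiv,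
    norm_iteratedFDeriv_zero] at h3
  exact ⟨h1, h2, h3⟩

/-- Smoothness of `V1` is not assumed: it is inherited from the uniform bounds on the second
derivatives of `V1e ε`. -/
theorem hasFDerivAt_limit (hV : Assumptions V1e V1 V2 xe x) (y : E d) :
    HasFDerivAt V1 (fderiv ℝ V1 y) y ∧
      Tendsto (fun ε => fderiv ℝ (V1e ε) y) (𝓝[>] 0) (𝓝 (fderiv ℝ V1 y)) := by
  obtain ⟨C, hC, h⟩ := hV.exists_norm_fderiv_le
  refine hasFDerivAt_and_tendsto_fderiv (L := C * Real.exp ((‖y‖ + 1) ^ 2))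
    (B := C * Real.exp (‖y‖ ^ 2)) one_pos ?_ ?_ hV.pointwise_limit
  · filter_upwards [h] with ε hε using (hε.2 _ y le_rfl).1
  · filter_upwards [h] with ε hε h hh
    have hs := hε.1
    refine norm_taylor_one_le (r := 1) (hs.differentiable (by norm_num))
      ((hs.fderiv_right (m := 3) (by norm_num)).differentiable (by norm_num)) (fun z hz => ?_) hh.le
    refine (hε.2 _ z ?_).2.1
    rw [Metric.mem_closedBall, dist_eq_norm] at hz
    linarith [norm_le_norm_add_norm_sub' z y]

/-- The same principle one order higher, applied to the functions `fderiv ℝ (V1e ε)` with their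
pointwise limit `fderiv ℝ V1`. -/
theorem tendsto_fderiv_fderiv (hV : Assumptions V1e V1 V2 xe x) (y : E d) :
    Tendsto (fun ε => fderiv ℝ (fderiv ℝ (V1e ε)) y) (𝓝[>] 0)
      (𝓝 (fderiv ℝ (fderiv ℝ V1) y)) := by
  obtain ⟨C, hC, h⟩ := hV.exists_norm_fderiv_le
  refine (hasFDerivAt_and_tendsto_fderiv (L := C * Real.exp ((‖y‖ + 1) ^ 2))
    (B := C * Real.exp (‖y‖ ^ 2)) one_pos ?_ ?_ fun z => (hV.hasFDerivAt_limit z).2).2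
  · filter_upwards [h] with ε hε using (hε.2 _ y le_rfl).2.1
  · filter_upwards [h] with ε hε h hh
    have hs : ContDiff ℝ 3 (fderiv ℝ (V1e ε)) := hε.1.fderiv_right (by norm_num)
    refine norm_taylor_one_le (r := 1) (hs.differentiable (by norm_num))
      ((hs.fderiv_right (m := 2) (by norm_num)).differentiable (by norm_num)) (fun z hz => ?_) hh.le
    refine (hε.2 _ z ?_).2.2
    rw [Metric.mem_closedBall, dist_eq_norm] at hz
    linarith [norm_le_norm_add_norm_sub' z y]

theorem eventually_norm_xe_le (hV : Assumptions V1e V1 V2 xe x) (i : Fin n) :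
    ∀ᶠ ε in 𝓝[>] (0 : ℝ), ‖xe ε i - x i‖ ≤ 1 := by
  have := (tendsto_iff_norm_sub_tendsto_zero.1 (hV.minimisers_tendsto i)).eventually_lt_const
    (zero_lt_one)
  exact this.mono fun _ h => h.le

/-- The third derivative bound makes the second derivatives equi-Lipschitz near `x i`, so the base
point may move with ε. -/
theorem tendsto_fderiv_fderiv_xe (hV : Assumptions V1e V1 V2 xe x) (i : Fin n) :
    Tendsto (fun ε => fderiv ℝ (fderiv ℝ (V1e ε)) (xe ε i)) (𝓝[>] 0)
      (𝓝 (fderiv ℝ (fderiv ℝ V1) (x i))) := by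
  obtain ⟨C, hC, h⟩ := hV.exists_norm_fderiv_le
  have h0 : Tendsto (fun ε => fderiv ℝ (fderiv ℝ (V1e ε)) (xe ε i)
      - fderiv ℝ (fderiv ℝ (V1e ε)) (x i)) (𝓝[>] 0) (𝓝 0) := by
    have hx := (tendsto_iff_norm_sub_tendsto_zero.1 (hV.minimisers_tendsto i)).const_mul
      (C * Real.exp ((‖x i‖ + 1) ^ 2))
    rw [mul_zero] at hx
    refine squeeze_zero_norm' ?_ hx
    filter_upwards [h, hV.eventually_norm_xe_le i] with ε hε hxe
    have hs : ContDiff ℝ 3 (fderiv ℝ (V1e ε)) := hε.1.fderiv_right (by norm_num)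
    have hs' : ContDiff ℝ 2 (fderiv ℝ (fderiv ℝ (V1e ε))) := hs.fderiv_right (by norm_num)
    refine (convex_closedBall (x i) 1).norm_image_sub_le_of_norm_fderiv_le
      (fun w _ => hs'.differentiable (by norm_num) w) (fun w hw => (hε.2 _ w ?_).2.2)
      (Metric.mem_closedBall_self zero_le_one) ?_
    · rw [Metric.mem_closedBall, dist_eq_norm] at hw
      linarith [norm_le_norm_add_norm_sub' w (x i)]
    · rwa [Metric.mem_closedBall, dist_eq_norm]
  simpa using h0.add (hV.tendsto_fderiv_fderiv (x i))

theorem fderiv_xe_eq_zero (hV : Assumptions V1e V1 V2 xe x) :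
    ∀ᶠ ε in 𝓝[>] (0 : ℝ), ∀ i, V1e ε (xe ε i) = 0 ∧ fderiv ℝ (V1e ε) (xe ε i) = 0 := by
  filter_upwards [hV.minimisers_eps] with ε hε i
  have : xe ε i ∈ {y | ∀ z, V1e ε y ≤ V1e ε z} := hε.1 ▸ Set.mem_range_self i
  refine ⟨hε.2 i, IsLocalMin.fderiv_eq_zero ?_⟩
  exact Eventually.of_forall this

/-- Second order Taylor expansion at the minimisers. -/
theorem exists_taylor_xe (hV : Assumptions V1e V1 V2 xe x) (r : ℝ) :
    ∃ L > 0, ∀ᶠ ε in 𝓝[>] (0 : ℝ), ∀ i h, ‖h‖ ≤ r →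
      |V1e ε (xe ε i + h) - 1 / 2 * fderiv ℝ (fderiv ℝ (V1e ε)) (xe ε i) h h| ≤ L * ‖h‖ ^ 3 := by
  obtain ⟨C, hC, h⟩ := hV.exists_norm_fderiv_le
  refine ⟨C * Real.exp ((∑ i, ‖x i‖ + 1 + r) ^ 2), by positivity, ?_⟩
  filter_upwards [h, eventually_all.2 hV.eventually_norm_xe_le, hV.fderiv_xe_eq_zero]
    with ε hε hxe hmin i v hv
  have := norm_taylor_two_le (hε.1.of_le (by norm_num)) (y := xe ε i) (r := r)
    (L := C * Real.exp ((∑ i, ‖x i‖ + 1 + r) ^ 2)) (fun z hz => (hε.2 _ z ?_).2.2) hv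
  · simpa [(hmin i).1, (hmin i).2] using this
  · rw [Metric.mem_closedBall, dist_eq_norm] at hz
    have h1 := norm_le_norm_add_norm_sub' z (xe ε i)
    have h2 := norm_le_norm_add_norm_sub' (xe ε i) (x i)
    have h3 := hxe i
    have h4 : ‖x i‖ ≤ ∑ i, ‖x i‖ :=
      Finset.single_le_sum (f := fun i => ‖x i‖) (fun _ _ => norm_nonneg _) (Finset.mem_univ i)
    linarith

/-- After division by ε the cubic Taylor remainder at `√ε • z` is at most `L * ‖z‖ ^ 3 * √ε`. -/
theorem tendsto_rescaled (hV : Assumptions V1e V1 V2 xe x) (i : Fin n) (z : E d) :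
    Tendsto (fun ε => V1e ε (xe ε i + √ε • z) / ε) (𝓝[>] 0)
      (𝓝 (1 / 2 * quadForm (hessian V1 (x i)) z)) := by
  obtain ⟨L, hL, h⟩ := hV.exists_taylor_xe ‖z‖
  have h1 : Tendsto (fun ε => 1 / 2 * fderiv ℝ (fderiv ℝ (V1e ε)) (xe ε i) z z) (𝓝[>] 0)
      (𝓝 (1 / 2 * quadForm (hessian V1 (x i)) z)) := by
    rw [← fderiv_fderiv_eq_quadForm]
    refine Tendsto.const_mul _ ?_
    have hc : Continuous fun B : E d →L[ℝ] E d →L[ℝ] ℝ => B z z := by fun_prop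
    exact (hc.tendsto _).comp (hV.tendsto_fderiv_fderiv_xe i)
  have hsqrt : Tendsto (fun ε : ℝ => L * ‖z‖ ^ 3 * √ε) (𝓝[>] 0) (𝓝 0) := by
    have : Tendsto (fun ε : ℝ => L * ‖z‖ ^ 3 * √ε) (𝓝 0) (𝓝 (L * ‖z‖ ^ 3 * √0)) :=
      (continuous_const.mul Real.continuous_sqrt).tendsto 0
    simpa using this.mono_left nhdsWithin_le_nhds
  have h2 : Tendsto (fun ε => V1e ε (xe ε i + √ε • z) / ε
      - 1 / 2 * fderiv ℝ (fderiv ℝ (V1e ε)) (xe ε i) z z) (𝓝[>] 0) (𝓝 0) := by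
    refine squeeze_zero_norm' ?_ hsqrt
    filter_upwards [h, Ioo_mem_nhdsGT one_pos] with ε hε hε1
    have hs1 : √ε ≤ 1 := Real.sqrt_le_one.2 hε1.2.le
    have hpos := hε1.1
    have := hε i (√ε • z) (by
      rw [norm_smul, Real.norm_of_nonneg (Real.sqrt_nonneg _)]
      exact mul_le_of_le_one_left (norm_nonneg _) hs1)
    simp only [map_smul, _root_.smul_apply, smul_eq_mul, norm_smul,
      Real.norm_of_nonneg (Real.sqrt_nonneg ε)] at this
    rw [← mul_assoc (√ε), Real.mul_self_sqrt hpos.le, mul_pow, pow_succ (√ε), Real.sq_sqrt hpos.le]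
      at this
    rw [Real.norm_eq_abs, show V1e ε (xe ε i + √ε • z) / ε
      - 1 / 2 * fderiv ℝ (fderiv ℝ (V1e ε)) (xe ε i) z z = (V1e ε (xe ε i + √ε • z)
      - 1 / 2 * (ε * fderiv ℝ (fderiv ℝ (V1e ε)) (xe ε i) z z)) / ε by field_simp, abs_div,
      abs_of_pos hpos, div_le_iff₀ hpos]
    linarith
  simpa using h2.add h1

/-- Second derivatives are bounded by the exponential growth at radius A + ‖h‖, and (A + ‖h‖)² ≤ 2A²
+ 2‖h‖². With h = √ε z, division by ε leaves C‖z‖² exp(2ε‖z‖²), which a Gaussian integrates for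
small ε. -/
theorem exists_le_sq_mul_exp (hV : Assumptions V1e V1 V2 xe x) :
    ∃ C > 0, ∀ᶠ ε in 𝓝[>] (0 : ℝ), ∀ i h,
      V1e ε (xe ε i + h) ≤ C * ‖h‖ ^ 2 * Real.exp (2 * ‖h‖ ^ 2) := by
  obtain ⟨C, hC, h⟩ := hV.exists_norm_fderiv_le
  refine ⟨C * Real.exp (2 * (∑ i, ‖x i‖ + 1) ^ 2), by positivity, ?_⟩
  filter_upwards [h, eventually_all.2 hV.eventually_norm_xe_le, hV.fderiv_xe_eq_zero]
    with ε hε hxe hmin i v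
  have := norm_taylor_one_le (hε.1.differentiable (by norm_num))
    ((hε.1.fderiv_right (m := 3) (by norm_num)).differentiable (by norm_num))
    (y := xe ε i) (r := ‖v‖) (L := C * Real.exp ((∑ i, ‖x i‖ + 1 + ‖v‖) ^ 2))
    (fun z hz => (hε.2 _ z ?_).2.1) le_rfl
  · simp only [(hmin i).1, (hmin i).2] at this
    simp only [sub_zero, _root_.zero_apply, Real.norm_eq_abs] at this
    refine (le_abs_self _).trans (this.trans ?_)
    rw [mul_assoc, mul_assoc, mul_assoc, mul_left_comm (Real.exp (2 * _)),
      ← Real.exp_add, mul_comm (‖v‖ ^ 2)]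
    gcongr
    nlinarith [sq_nonneg (∑ i, ‖x i‖ + 1 - ‖v‖)]
  · rw [Metric.mem_closedBall, dist_eq_norm] at hz
    have h1 := norm_le_norm_add_norm_sub' z (xe ε i)
    have h2 := norm_le_norm_add_norm_sub' (xe ε i) (x i)
    have h3 := hxe i
    have h4 : ‖x i‖ ≤ ∑ i, ‖x i‖ :=
      Finset.single_le_sum (f := fun i => ‖x i‖) (fun _ _ => norm_nonneg _) (Finset.mem_univ i)
    linarith

end Assumptions

end GaussMix

/-! ### Uniform quadratic growth away from the minimisers -/

namespace GaussMix
namespace Assumptions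

variable {d n : ℕ} {V1e : ℝ → E d → ℝ} {V1 V2 : E d → ℝ} {xe : ℝ → Fin n → E d} {x : Fin n → E d}

/-- A point that is not a minimiser lies strictly above some value of `V1`, and all values are
non-negative as limits. The minimal value itself is not needed. -/
theorem limit_pos (hV : Assumptions V1e V1 V2 xe x) {y : E d} (hy : y ∉ Set.range x) :
    0 < V1 y := by
  have hnonneg : ∀ z, 0 ≤ V1 z := fun z =>
    ge_of_tendsto (hV.pointwise_limit z)
      (by filter_upwards [self_mem_nhdsWithin] with ε hε using hV.V1e_nonneg ε hε z)
  rw [← hV.minimisers] at hy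
  simp only [Set.mem_ofPred_eq, not_forall, not_le] at hy
  obtain ⟨z, hz⟩ := hy
  exact (hnonneg z).trans_lt hz

theorem quadratic_lower_bound_near_minimiser (hV : Assumptions V1e V1 V2 xe x) (i : Fin n) :
    ∃ c > 0, ∀ᶠ p in 𝓝[>] (0 : ℝ) ×ˢ 𝓝 (x i), c * ‖p.2 - xe p.1 i‖ ^ 2 ≤ V1e p.1 p.2 := by
  obtain ⟨lam, hlam, hq⟩ := exists_pos_le_quadForm (hV.hessian_posDef i)
  obtain ⟨L, hL, hT⟩ := hV.exists_taylor_xe 1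
  -- The Hessian of the limit gives λ/2; replacing it by that of `V1e ε` costs λ/8, and the cubic
  -- remainder costs λ/4.
  refine ⟨lam / 8, by positivity, ?_⟩
  have hD : ∀ᶠ ε in 𝓝[>] (0 : ℝ), ‖fderiv ℝ (fderiv ℝ (V1e ε)) (xe ε i)
      - fderiv ℝ (fderiv ℝ V1) (x i)‖ < lam / 4 :=
    (tendsto_iff_norm_sub_tendsto_zero.1 (hV.tendsto_fderiv_fderiv_xe i)).eventually_lt_const
      (by positivity)
  have hnear : ∀ᶠ p in 𝓝[>] (0 : ℝ) ×ˢ 𝓝 (x i), ‖p.2 - xe p.1 i‖ < min 1 (lam / (4 * L)) := by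
    have h : Tendsto (fun p : ℝ × E d => ‖p.2 - xe p.1 i‖) (𝓝[>] (0 : ℝ) ×ˢ 𝓝 (x i)) (𝓝 0) := by
      have := (tendsto_snd (f := 𝓝[>] (0 : ℝ)) (g := 𝓝 (x i))).sub
        ((hV.minimisers_tendsto i).comp tendsto_fst)
      simpa using this.norm
    exact h.eventually_lt_const (by positivity)
  filter_upwards [hnear, (hT.and hD).prod_inl (𝓝 (x i))] with ⟨ε, y⟩ hy ⟨hT, hD⟩
  simp only at hy hT hD ⊢
  set h := y - xe ε i with hh
  have hyh : y = xe ε i + h := by simp [hh]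
  have h1 := hT i h (hy.le.trans (min_le_left _ _))
  have h2 : |(fderiv ℝ (fderiv ℝ (V1e ε)) (xe ε i) - fderiv ℝ (fderiv ℝ V1) (x i)) h h|
      ≤ lam / 4 * ‖h‖ * ‖h‖ :=
    ((_ : E d →L[ℝ] E d →L[ℝ] ℝ).le_opNorm₂ h h).trans (by gcongr)
  simp only [_root_.sub_apply, fderiv_fderiv_eq_quadForm] at h2
  rw [fderiv_fderiv_eq_quadForm] at h1
  have h3 := hq h
  have h4 : L * ‖h‖ ^ 3 ≤ lam / 4 * ‖h‖ ^ 2 := by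
    have : ‖h‖ * (4 * L) ≤ lam := by
      rw [← le_div_iff₀ (by positivity)]
      exact hy.le.trans (min_le_right _ _)
    nlinarith [sq_nonneg ‖h‖]
  rw [← hyh] at h1
  have h5 := abs_le.1 h1
  have h6 := abs_le.1 h2
  nlinarith [sq_nonneg ‖h‖]

/-- The potentials are uniformly Lipschitz near y₀, so convergence at y₀ alone keeps them above
V₁(y₀)/4 on a neighbourhood. Since the distance to any minimiser is bounded there, the index is
arbitrary. -/
theorem quadratic_lower_bound_away (hV : Assumptions V1e V1 V2 xe x) (i : Fin n) {y₀ : E d}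
    (hy₀ : y₀ ∉ Set.range x) :
    ∃ c > 0, ∀ᶠ p in 𝓝[>] (0 : ℝ) ×ˢ 𝓝 y₀, c * ‖p.2 - xe p.1 i‖ ^ 2 ≤ V1e p.1 p.2 := by
  have hpos := hV.limit_pos hy₀
  obtain ⟨C, hC, h⟩ := hV.exists_norm_fderiv_le
  set L := C * Real.exp ((‖y₀‖ + 1) ^ 2) with hL
  have hL0 : 0 < L := by positivity
  set D := ‖y₀‖ + 1 + (‖x i‖ + 1) with hDdef
  have hD0 : 0 < D := by positivity
  refine ⟨V1 y₀ / 4 / D ^ 2, by positivity, ?_⟩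
  have hev : ∀ᶠ ε in 𝓝[>] (0 : ℝ), V1 y₀ / 2 < V1e ε y₀ :=
    (hV.pointwise_limit y₀).eventually_const_lt (by linarith)
  have hnear : ∀ᶠ y in 𝓝 y₀, ‖y - y₀‖ < min 1 (V1 y₀ / 4 / L) := by
    have : Tendsto (fun y => ‖y - y₀‖) (𝓝 y₀) (𝓝 0) :=
      tendsto_iff_norm_sub_tendsto_zero.1 tendsto_id
    exact this.eventually_lt_const (by positivity)
  filter_upwards [((hev.and (h.and (hV.eventually_norm_xe_le i))).prod_mk hnear)]
    with ⟨ε, y⟩ ⟨⟨hε, hC', hxe⟩, hy⟩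
  simp only at hε hC' hxe hy ⊢
  have hy1 : ‖y - y₀‖ ≤ 1 := hy.le.trans (min_le_left _ _)
  have hlip : ‖V1e ε y - V1e ε y₀‖ ≤ L * ‖y - y₀‖ := by
    refine (convex_closedBall y₀ 1).norm_image_sub_le_of_norm_fderiv_le
      (fun w _ => hC'.1.differentiable (by norm_num) w) (fun w hw => (hC'.2 _ w ?_).1)
      (Metric.mem_closedBall_self zero_le_one) ?_
    · rw [Metric.mem_closedBall, dist_eq_norm] at hw
      linarith [norm_le_norm_add_norm_sub' w y₀]
    · rwa [Metric.mem_closedBall, dist_eq_norm]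
  have hlip' : L * ‖y - y₀‖ ≤ V1 y₀ / 4 := by
    rw [mul_comm, ← le_div_iff₀ hL0]
    exact hy.le.trans (min_le_right _ _)
  have hdist : ‖y - xe ε i‖ ≤ D := by
    have h1 := norm_sub_le y (xe ε i)
    have h2 := norm_le_norm_add_norm_sub' y y₀
    have h3 := norm_le_norm_add_norm_sub' (xe ε i) (x i)
    linarith
  have h4 := abs_le.1 hlip
  calc V1 y₀ / 4 / D ^ 2 * ‖y - xe ε i‖ ^ 2 ≤ V1 y₀ / 4 / D ^ 2 * D ^ 2 := by gcongr
    _ = V1 y₀ / 4 := by field_simp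
    _ ≤ V1e ε y := by linarith [h4.1]

/-- `V₁^ε` is bounded below by a multiple of the squared distance to its minimisers. -/
theorem exists_quadratic_lower_bound (hV : Assumptions V1e V1 V2 xe x) :
    ∃ c > 0, ∀ᶠ ε in 𝓝[>] (0 : ℝ), ∀ y, ∃ j, c * ‖y - xe ε j‖ ^ 2 ≤ V1e ε y := by
  have hlocal : ∀ K : Set (E d), IsCompact K →
      ∃ c > 0, ∀ᶠ ε in 𝓝[>] (0 : ℝ), ∀ y ∈ K, ∃ j, c * ‖y - xe ε j‖ ^ 2 ≤ V1e ε y := by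
    intro K hK
    refine IsCompact.induction_on (p := fun K => ∃ c > 0, ∀ᶠ ε in 𝓝[>] (0 : ℝ), ∀ y ∈ K,
      ∃ j, c * ‖y - xe ε j‖ ^ 2 ≤ V1e ε y) hK ⟨1, one_pos, by simp⟩ ?_ ?_ ?_
    · intro s t hst ht
      obtain ⟨c, hc, h⟩ := ht
      exact ⟨c, hc, h.mono fun ε hε y hy => hε y (hst hy)⟩
    · intro s t hs ht
      obtain ⟨c, hc, h⟩ := hs
      obtain ⟨c', hc', h'⟩ := ht
      refine ⟨min c c', lt_min hc hc', ?_⟩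
      filter_upwards [h, h'] with ε hε hε' y hy
      rcases hy with hy | hy
      · obtain ⟨j, hj⟩ := hε y hy
        exact ⟨j, le_trans (by gcongr; exact min_le_left _ _) hj⟩
      · obtain ⟨j, hj⟩ := hε' y hy
        exact ⟨j, le_trans (by gcongr; exact min_le_right _ _) hj⟩
    · intro y₀ hy₀
      have : ∃ i, ∃ c > 0, ∀ᶠ p in 𝓝[>] (0 : ℝ) ×ˢ 𝓝 y₀,
          c * ‖p.2 - xe p.1 i‖ ^ 2 ≤ V1e p.1 p.2 := by
        by_cases hy : y₀ ∈ Set.range x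
        · obtain ⟨i, rfl⟩ := hy
          exact ⟨i, hV.quadratic_lower_bound_near_minimiser i⟩
        · exact ⟨⟨0, hV.n_pos⟩, hV.quadratic_lower_bound_away _ hy⟩
      obtain ⟨i, c, hc, h⟩ := this
      obtain ⟨p, hp, q, hq, hpq⟩ := eventually_prod_iff.1 h
      refine ⟨{y | q y}, mem_nhdsWithin_of_mem_nhds hq, c, hc, ?_⟩
      filter_upwards [hp] with ε hε y hy using ⟨i, hpq hε hy⟩
  obtain ⟨c₀, hc₀, c₁, hc₁, ε₀, hε₀, hco⟩ := hV.coercive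
  set i₀ : Fin n := ⟨0, hV.n_pos⟩
  set B := ‖x i₀‖ + 1 with hB
  -- Beyond this radius, half of c₁‖y‖² absorbs c₀ and still leaves c₁B²/2. The remainder c₁(‖y‖² +
  -- B²)/2 dominates c₁/4 times the squared distance to `xe ε i₀`.
  set R := √((2 * c₀ + c₁ * B ^ 2) / c₁) with hR
  obtain ⟨c, hc, h⟩ := hlocal _ (isCompact_closedBall (0 : E d) R)
  refine ⟨min c (c₁ / 4), by positivity, ?_⟩
  filter_upwards [h, Ioo_mem_nhdsGT hε₀, hV.eventually_norm_xe_le i₀] with ε hε hε' hxe y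
  by_cases hy : ‖y‖ ≤ R
  · obtain ⟨j, hj⟩ := hε y (by simpa using hy)
    exact ⟨j, le_trans (by gcongr; exact min_le_left _ _) hj⟩
  · refine ⟨i₀, le_trans ?_ (hco ε hε'.1 hε'.2 y)⟩
    have h1 : (2 * c₀ + c₁ * B ^ 2) / c₁ ≤ ‖y‖ ^ 2 := by
      rw [← Real.sq_sqrt (show 0 ≤ (2 * c₀ + c₁ * B ^ 2) / c₁ by positivity)]
      have := not_le.1 hy
      gcongr
    rw [div_le_iff₀ hc₁] at h1
    have h2 : ‖y - xe ε i₀‖ ≤ ‖y‖ + B := by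
      have h1 := norm_sub_le y (xe ε i₀)
      have h3 := norm_le_norm_add_norm_sub' (xe ε i₀) (x i₀)
      linarith
    have h3 : ‖y - xe ε i₀‖ ^ 2 ≤ 2 * ‖y‖ ^ 2 + 2 * B ^ 2 := by
      calc ‖y - xe ε i₀‖ ^ 2 ≤ (‖y‖ + B) ^ 2 := by gcongr
        _ ≤ _ := by nlinarith [sq_nonneg (‖y‖ - B)]
    calc min c (c₁ / 4) * ‖y - xe ε i₀‖ ^ 2 ≤ c₁ / 4 * (2 * ‖y‖ ^ 2 + 2 * B ^ 2) := by
          gcongr; exact min_le_right _ _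
      _ ≤ _ := by nlinarith

end Assumptions
end GaussMix

/-! ### Scaling and densities of multivariate Gaussians -/

namespace GaussMix

open ProbabilityTheory Matrix

variable {d : ℕ}

theorem charFun_multivariateGaussian_eq {m : E d} {S : Matrix (Fin d) (Fin d) ℝ}
    (hS : S.PosSemidef) (t : E d) :
    charFun (multivariateGaussian m S) t =
      Complex.exp (inner ℝ t m * Complex.I - quadForm S t / 2) :=
  charFun_multivariateGaussian hS t

theorem map_affine_multivariateGaussian {m : E d} {S : Matrix (Fin d) (Fin d) ℝ}
    (hS : S.PosSemidef) (a : E d) (c : ℝ) :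
    (multivariateGaussian m S).map (fun z => a + c • z) =
      multivariateGaussian (a + c • m) (c ^ 2 • S) := by
  have hf : Measurable fun z : E d => a + c • z := by fun_prop
  have := Measure.isProbabilityMeasure_map (μ := multivariateGaussian m S) hf.aemeasurable
  refine Measure.ext_of_charFun ?_
  funext t
  rw [charFun_multivariateGaussian_eq (hS.smul (sq_nonneg c)), charFun_apply,
    integral_map hf.aemeasurable (by fun_prop)]
  have h1 : ∀ z : E d, Complex.exp (inner ℝ (a + c • z) t * Complex.I) =
      Complex.exp (inner ℝ t a * Complex.I) * Complex.exp (inner ℝ z (c • t) * Complex.I) := by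
    intro z
    rw [← Complex.exp_add, inner_add_left, inner_smul_left, inner_smul_right, real_inner_comm]
    congr 1
    push_cast
    simp
    ring
  simp_rw [h1]
  rw [integral_const_mul, ← charFun_apply, charFun_multivariateGaussian_eq hS, ← Complex.exp_add,
    quadForm_smul]
  congr 1
  simp only [quadForm, inner_add_right, inner_smul_right, inner_smul_left, smul_mulVec,
    dotProduct_smul, smul_eq_mul]
  push_cast
  simp
  ring

theorem multivariateGaussian_smul_eq_map {S : Matrix (Fin d) (Fin d) ℝ} (hS : S.PosSemidef)
    (m : E d) {ε : ℝ} (hε : 0 ≤ ε) :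
    multivariateGaussian m (ε • S) = (multivariateGaussian 0 S).map (fun z => m + √ε • z) := by
  rw [map_affine_multivariateGaussian hS, Real.sq_sqrt hε]
  simp

/-- The density of `N(0, H⁻¹)`. -/
noncomputable def gaussDensity (H : Matrix (Fin d) (Fin d) ℝ) (z : E d) : ℝ :=
  (2 * Real.pi) ^ (-(d / 2 : ℝ)) * √H.det * Real.exp (-(1 / 2 * quadForm H z))

theorem continuous_gaussDensity (H : Matrix (Fin d) (Fin d) ℝ) : Continuous (gaussDensity H) := by
  have := continuous_quadForm H
  unfold gaussDensity
  fun_prop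

theorem gaussDensity_pos {H : Matrix (Fin d) (Fin d) ℝ} (hH : H.PosDef) (z : E d) :
    0 < gaussDensity H z := by
  have := hH.det_pos
  have := Real.pi_pos
  unfold gaussDensity
  positivity

theorem gaussDensity_le {H : Matrix (Fin d) (Fin d) ℝ} (hH : H.PosDef) (z : E d) :
    gaussDensity H z ≤ gaussDensity H 0 := by
  unfold gaussDensity
  have := quadForm_nonneg hH.posSemidef z
  gcongr
  simpa [quadForm] using this

theorem quadForm_one (z : E d) : quadForm 1 z = ‖z‖ ^ 2 := by
  rw [EuclideanSpace.real_norm_sq_eq]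
  simp [quadForm, dotProduct, sq]

/-- Both measures have the same characteristic function, by the Fourier transform of a Gaussian. -/
theorem stdGaussian_eq_withDensity :
    stdGaussian (E d) =
      volume.withDensity fun z =>
        ENNReal.ofReal (gaussDensity (1 : Matrix (Fin d) (Fin d) ℝ) z) := by
  set c := (2 * Real.pi) ^ (-(d / 2 : ℝ)) with hc
  have hc0 : 0 < c := by have := Real.pi_pos; positivity
  have hform : ∀ z : E d, gaussDensity (1 : Matrix (Fin d) (Fin d) ℝ) z =
      c * Real.exp (-(1 / 2) * ‖z‖ ^ 2) := by
    intro z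
    simp [gaussDensity, quadForm_one, hc]
  have hint : ∀ t : E d, ∫ z : E d, Complex.exp (inner ℝ z t * Complex.I) *
      (gaussDensity (1 : Matrix (Fin d) (Fin d) ℝ) z : ℂ) = Complex.exp (-‖t‖ ^ 2 / 2) := by
    intro t
    have h1 := GaussianFourier.integral_cexp_neg_mul_sq_norm_add (V := E d)
      (b := (1 / 2 : ℂ)) (by norm_num) Complex.I t
    have h2 : ∀ z : E d, Complex.exp (inner ℝ z t * Complex.I) *
        (gaussDensity (1 : Matrix (Fin d) (Fin d) ℝ) z : ℂ) =
        (c : ℂ) * Complex.exp (-(1 / 2 : ℂ) * ‖z‖ ^ 2 + Complex.I * inner ℝ t z) := by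
      intro z
      rw [hform, Complex.exp_add]
      push_cast
      rw [real_inner_comm, mul_comm Complex.I]
      ring
    simp_rw [h2]
    rw [integral_const_mul, h1]
    have h3 : (c : ℂ) * (Real.pi / (1 / 2 : ℂ)) ^ (Module.finrank ℝ (E d) / 2 : ℂ) = 1 := by
      have h4 : (Real.pi / (1 / 2 : ℂ)) = ((2 * Real.pi : ℝ) : ℂ) := by push_cast; ring
      have hp : (0 : ℝ) < 2 * Real.pi := by have := Real.pi_pos; positivity
      rw [h4, finrank_euclideanSpace_fin, hc,
        show ((d : ℂ) / 2) = ((d / 2 : ℝ) : ℂ) by push_cast; ring,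
        ← Complex.ofReal_cpow hp.le, ← Complex.ofReal_mul, ← Real.rpow_add hp]
      simp
    rw [← mul_assoc, h3, one_mul]
    congr 1
    rw [Complex.I_sq]
    ring
  have hgint : Integrable (fun z : E d => gaussDensity (1 : Matrix (Fin d) (Fin d) ℝ) z) := by
    -- The Fourier integral at 0 equals 1, whereas the integral of a non-integrable function is 0 by
    -- convention.
    by_contra hni
    have h0 := hint 0
    simp only [inner_zero_right, Complex.ofReal_zero, zero_mul, Complex.exp_zero, one_mul] at h0
    rw [integral_complex_ofReal, integral_undef hni] at h0
    simp at h0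
  have hfin : IsFiniteMeasure (volume.withDensity fun z : E d =>
      ENNReal.ofReal (gaussDensity (1 : Matrix (Fin d) (Fin d) ℝ) z)) :=
    isFiniteMeasure_withDensity_ofReal hgint.2
  refine Measure.ext_of_charFun ?_
  funext t
  rw [charFun_stdGaussian, charFun_apply, integral_withDensity_eq_integral_toReal_smul
    (by have := continuous_gaussDensity (1 : Matrix (Fin d) (Fin d) ℝ); fun_prop) (by simp),
    ← hint t]
  refine integral_congr_ae (Eventually.of_forall fun z => ?_)
  simp only [ENNReal.toReal_ofReal (gaussDensity_pos Matrix.PosDef.one z).le, Complex.real_smul]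
  ring

theorem map_withDensity_of_linear {f : E d →ₗ[ℝ] E d} (hf : LinearMap.det f ≠ 0) {g : E d → E d}
    (hg : Measurable g) (hgf : ∀ z, g (f z) = z) {ρ : E d → ℝ≥0∞} (hρ : Measurable ρ) (m : E d) :
    (volume.withDensity ρ).map (fun z => m + f z) =
      volume.withDensity fun y => ENNReal.ofReal |(LinearMap.det f)⁻¹| * ρ (g (y - m)) := by
  have hfm : Measurable f := f.continuous_of_finiteDimensional.measurable
  have hT : Measurable fun z => m + f z := hfm.const_add m
  have hvol : (volume : Measure (E d)).map (fun z => m + f z) =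
      ENNReal.ofReal |(LinearMap.det f)⁻¹| • volume := by
    have : (fun z => m + f z) = (fun y => m + y) ∘ f := rfl
    rw [this, ← Measure.map_map (measurable_const_add m) hfm,
      Measure.map_linearMap_addHaar_eq_smul_addHaar _ hf, Measure.map_smul,
      (measurePreserving_add_left volume m).map_eq]
  have hcomp : Measurable fun y => ρ (g (y - m)) := hρ.comp (hg.comp (measurable_id.sub_const m))
  ext s hs
  rw [Measure.map_apply hT hs, withDensity_apply _ (hT hs), withDensity_apply _ hs,
    lintegral_const_mul _ hcomp, ← lintegral_indicator hs, ← lintegral_indicator (hT hs)]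
  calc ∫⁻ z, ((fun z => m + f z) ⁻¹' s).indicator ρ z
      = ∫⁻ z, s.indicator (fun y => ρ (g (y - m))) (m + f z) := by
        congr 1
        funext z
        by_cases h : m + f z ∈ s
        · have h' : z ∈ (fun z => m + f z) ⁻¹' s := h
          rw [Set.indicator_of_mem h, Set.indicator_of_mem h']
          simp [hgf]
        · have h' : z ∉ (fun z => m + f z) ⁻¹' s := h
          rw [Set.indicator_of_notMem h, Set.indicator_of_notMem h']
    _ = ∫⁻ y, s.indicator (fun y => ρ (g (y - m))) y ∂(volume.map fun z => m + f z) :=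
        (lintegral_map (hcomp.indicator hs) hT).symm
    _ = _ := by rw [hvol, lintegral_smul_measure]; rfl

open scoped MatrixOrder in
-- This measure is the image of the standard Gaussian under B = √(H⁻¹). The change of variables uses
-- B⁻¹B⁻¹ = H in the exponent and |det B⁻¹| = √(det H) in the prefactor.
theorem multivariateGaussian_inv_eq_withDensity {H : Matrix (Fin d) (Fin d) ℝ} (hH : H.PosDef) :
    multivariateGaussian 0 H⁻¹ = volume.withDensity fun z => ENNReal.ofReal (gaussDensity H z) := by
  set B := CFC.sqrt H⁻¹ with hB
  have hA : (H⁻¹).PosSemidef := hH.inv.posSemidef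
  have hBB : B * B = H⁻¹ := CFC.sqrt_mul_sqrt_self _ hA.nonneg
  have hBh : B.IsHermitian := (CFC.sqrt_nonneg H⁻¹).isSelfAdjoint
  have hdet : B.det * B.det = H.det⁻¹ := by
    rw [← det_mul, hBB, det_nonsing_inv, Ring.inverse_eq_inv']
  have hHdet := hH.det_pos
  have hB0 : B.det ≠ 0 := by
    intro h
    rw [h, zero_mul] at hdet
    exact (inv_pos.2 hHdet).ne hdet
  have hBu : IsUnit B.det := isUnit_iff_ne_zero.2 hB0
  have hinv : B⁻¹ * B⁻¹ = H := by
    rw [← Matrix.mul_inv_rev, hBB, nonsing_inv_nonsing_inv _ (isUnit_iff_ne_zero.2 hHdet.ne')]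
  set f : E d →ₗ[ℝ] E d := toEuclideanLin B with hf
  have hfdet : LinearMap.det f = B.det := by
    rw [hf, toEuclideanLin_eq_toLin_orthonormal, LinearMap.det_toLin]
  have hgf : ∀ z, toEuclideanCLM (𝕜 := ℝ) B⁻¹ (f z) = z := by
    intro z
    have : f z = toEuclideanCLM (𝕜 := ℝ) B z := rfl
    rw [this, ← mul_apply_eq_comp, ← map_mul, nonsing_inv_mul _ hBu, map_one]
    rfl
  have hq : ∀ z, quadForm 1 (toEuclideanCLM (𝕜 := ℝ) B⁻¹ z) = quadForm H z := by
    intro z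
    have hBi : (B⁻¹)ᵀ = B⁻¹ := by
      rw [transpose_nonsing_inv]
      simpa using congrArg (·⁻¹) hBh.eq
    simp only [quadForm, ofLp_toEuclideanCLM, one_mulVec]
    rw [dotProduct_mulVec, ← mulVec_transpose, hBi, mulVec_mulVec, hinv, dotProduct_comm]
  have hdet' : |B.det⁻¹| = √H.det := by
    rw [← Real.sqrt_sq_eq_abs, inv_pow, sq, hdet, inv_inv]
  have hmeas : Measurable fun z : E d =>
      ENNReal.ofReal (gaussDensity (1 : Matrix (Fin d) (Fin d) ℝ) z) := by
    have := continuous_gaussDensity (1 : Matrix (Fin d) (Fin d) ℝ)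
    fun_prop
  have key := map_withDensity_of_linear (f := f) (hfdet ▸ hB0)
    (toEuclideanCLM (𝕜 := ℝ) B⁻¹).continuous.measurable hgf hmeas 0
  rw [← stdGaussian_eq_withDensity] at key
  have hdef : multivariateGaussian 0 H⁻¹ = (stdGaussian (E d)).map (fun z => 0 + f z) := rfl
  rw [hdef, key]
  congr 1
  funext z
  rw [hfdet, hdet', ← ENNReal.ofReal_mul (Real.sqrt_nonneg _)]
  congr 1
  simp only [gaussDensity, sub_zero, hq]
  simp
  ring

/-- The density of `N(m, ε H⁻¹)`. -/
theorem multivariateGaussian_smul_inv_eq_withDensity {H : Matrix (Fin d) (Fin d) ℝ} (hH : H.PosDef)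
    (m : E d) {ε : ℝ} (hε : 0 < ε) :
    multivariateGaussian m (ε • H⁻¹) = volume.withDensity fun y =>
      ENNReal.ofReal ((√ε ^ d)⁻¹ * gaussDensity H ((√ε)⁻¹ • (y - m))) := by
  have hs : 0 < √ε := Real.sqrt_pos.2 hε
  have hmeas : Measurable fun z : E d => ENNReal.ofReal (gaussDensity H z) := by
    have := continuous_gaussDensity H
    fun_prop
  have hdet : LinearMap.det (√ε • (LinearMap.id : E d →ₗ[ℝ] E d)) = √ε ^ d := by
    simp [LinearMap.det_smul]
  have key := map_withDensity_of_linear (f := √ε • LinearMap.id) (g := fun z : E d => (√ε)⁻¹ • z)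
    (by rw [hdet]; positivity) (by fun_prop) (fun z => by simp [smul_smul, hs.ne']) hmeas m
  rw [multivariateGaussian_smul_eq_map hH.inv.posSemidef m hε.le,
    multivariateGaussian_inv_eq_withDensity hH]
  refine key.trans ?_
  congr 1
  funext y
  rw [hdet, abs_of_pos (by positivity), ← ENNReal.ofReal_mul (by positivity)]

/-- The normalisation needs no computation: it is the total mass of `multivariateGaussian 0 H⁻¹`. -/
theorem integral_gaussDensity {H : Matrix (Fin d) (Fin d) ℝ} (hH : H.PosDef) :
    Integrable (gaussDensity H) ∧ ∫ z, gaussDensity H z = 1 := by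
  have h1 : ∫⁻ z, ENNReal.ofReal (gaussDensity H z) = 1 := by
    have := (isGaussian_multivariateGaussian (μ := (0 : E d)) (S := H⁻¹)).toIsProbabilityMeasure
    rw [← measure_univ (μ := multivariateGaussian (0 : E d) H⁻¹),
      multivariateGaussian_inv_eq_withDensity hH]
    simp
  have h0 : 0 ≤ᵐ[volume] gaussDensity H :=
    Eventually.of_forall fun z => (gaussDensity_pos hH z).le
  have hm := (continuous_gaussDensity H).aestronglyMeasurable (μ := volume)
  refine ⟨⟨hm, ?_⟩, ?_⟩
  · rw [hasFiniteIntegral_iff_ofReal h0, h1]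
    exact ENNReal.one_lt_top
  · rw [integral_eq_lintegral_of_nonneg_ae h0 hm, h1]
    simp

end GaussMix

/-! ### Divergence between densities, integrals over mixtures, and the weights -/

namespace GaussMix

open ProbabilityTheory Matrix

/-- Positivity of `q` gives absolute continuity with derivative `p / q`. Both total masses are 1, so
the mass correction in `klDiv` drops out. -/
theorem klDiv_withDensity_eq {X : Type*} [MeasurableSpace X] {μ : Measure X} [SigmaFinite μ]
    {p q : X → ℝ}
    (hp : Measurable p) (hq : Measurable q) (hp0 : ∀ y, 0 < p y) (hq0 : ∀ y, 0 < q y)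
    [IsProbabilityMeasure (μ.withDensity fun y => ENNReal.ofReal (p y))]
    [IsProbabilityMeasure (μ.withDensity fun y => ENNReal.ofReal (q y))]
    (hint : Integrable (fun y => Real.log (p y) - Real.log (q y))
      (μ.withDensity fun y => ENNReal.ofReal (p y))) :
    InformationTheory.klDiv (μ.withDensity fun y => ENNReal.ofReal (p y))
        (μ.withDensity fun y => ENNReal.ofReal (q y)) =
      ENNReal.ofReal (∫ y, Real.log (p y) - Real.log (q y)
        ∂(μ.withDensity fun y => ENNReal.ofReal (p y))) := by
  set P := μ.withDensity fun y => ENNReal.ofReal (p y) with hP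
  set Q := μ.withDensity fun y => ENNReal.ofReal (q y) with hQ
  have hpq : Measurable fun y => ENNReal.ofReal (p y / q y) := (hp.div hq).ennreal_ofReal
  have hPQ : P = Q.withDensity fun y => ENNReal.ofReal (p y / q y) := by
    rw [hQ, ← withDensity_mul _ hq.ennreal_ofReal hpq, hP]
    congr 1
    funext y
    rw [Pi.mul_apply, ← ENNReal.ofReal_mul (hq0 y).le, mul_div_cancel₀ _ (hq0 y).ne']
  have hac : P ≪ Q := by
    rw [hPQ]
    exact withDensity_absolutelyContinuous _ _
  have hrn : P.rnDeriv Q =ᵐ[Q] fun y => ENNReal.ofReal (p y / q y) := by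
    conv_lhs => rw [hPQ]
    exact Measure.rnDeriv_withDensity Q hpq
  have hllr : llr P Q =ᵐ[P] fun y => Real.log (p y) - Real.log (q y) := by
    filter_upwards [hac.ae_le hrn] with y hy
    rw [llr, hy, ENNReal.toReal_ofReal (div_pos (hp0 y) (hq0 y)).le,
      Real.log_div (hp0 y).ne' (hq0 y).ne']
  rw [InformationTheory.klDiv_of_ac_of_integrable hac (hint.congr hllr.symm)]
  simp [integral_congr_ae hllr]

variable {d n : ℕ}

/-- Near one minimiser, the rescaled distance to the others tends to infinity; this makes their
components negligible there. -/
theorem tendsto_gaussDensity_cobounded {H : Matrix (Fin d) (Fin d) ℝ} (hH : H.PosDef) :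
    Tendsto (gaussDensity H) (Bornology.cobounded (E d)) (𝓝 0) := by
  obtain ⟨c, hc, hq⟩ := exists_pos_le_quadForm hH
  have h1 : Tendsto (fun z : E d => 1 / 2 * (c * ‖z‖ ^ 2)) (Bornology.cobounded (E d)) atTop :=
    ((((tendsto_pow_atTop two_ne_zero).comp tendsto_norm_cobounded_atTop).const_mul_atTop
      hc)).const_mul_atTop (by norm_num)
  have h2 := (Real.tendsto_exp_neg_atTop_nhds_zero.comp h1).const_mul (gaussDensity H 0)
  rw [mul_zero] at h2
  refine squeeze_zero (fun z => (gaussDensity_pos hH z).le) (fun z => ?_) h2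
  simp only [gaussDensity, Function.comp]
  have h0 : quadForm H 0 = 0 := by simp [quadForm]
  rw [h0]
  simp only [mul_zero, neg_zero, Real.exp_zero, mul_one]
  gcongr
  exact hq z

theorem log_gaussDensity {H : Matrix (Fin d) (Fin d) ℝ} (hH : H.PosDef) (z : E d) :
    Real.log (gaussDensity H z) = Real.log (gaussDensity H 0) - 1 / 2 * quadForm H z := by
  have h0 : quadForm H 0 = 0 := by simp [quadForm]
  have : gaussDensity H z = gaussDensity H 0 * Real.exp (-(1 / 2 * quadForm H z)) := by
    simp [gaussDensity, h0]
  rw [this, Real.log_mul (gaussDensity_pos hH 0).ne' (Real.exp_pos _).ne', Real.log_exp]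
  ring

theorem integral_exp_neg_quadForm {H : Matrix (Fin d) (Fin d) ℝ} (hH : H.PosDef) :
    Integrable (fun z => Real.exp (-(1 / 2 * quadForm H z))) ∧
      ∫ z, Real.exp (-(1 / 2 * quadForm H z)) = (gaussDensity H 0)⁻¹ := by
  have h0 : quadForm H 0 = 0 := by simp [quadForm]
  have hpos := gaussDensity_pos hH 0
  have h : (fun z => Real.exp (-(1 / 2 * quadForm H z))) =
      fun z => (gaussDensity H 0)⁻¹ * gaussDensity H z := by
    funext z
    rw [eq_inv_mul_iff_mul_eq₀ hpos.ne']
    simp [gaussDensity, h0]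
  rw [h]
  exact ⟨(integral_gaussDensity hH).1.const_mul _, by
    rw [integral_const_mul, (integral_gaussDensity hH).2, mul_one]⟩

/-- Pulling each component back to `multivariateGaussian 0 (p.2.2 i)`, which does not involve ε,
moves all dependence on ε into the integrand, as dominated convergence requires. -/
theorem integral_mixture {ε : ℝ} (hε : 0 ≤ ε) {p : Params n d} (hp : p ∈ domain n d)
    (hα : ∀ i, 0 ≤ p.1 i) {F : Type*} [NormedAddCommGroup F] [NormedSpace ℝ F] {f : E d → F}
    (hf : StronglyMeasurable f)
    (hint : ∀ i, Integrable (fun z => f (p.2.1 i + √ε • z)) (multivariateGaussian 0 (p.2.2 i))) :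
    Integrable f (mixture ε p) ∧ ∫ y, f y ∂(mixture ε p) =
      ∑ i, p.1 i • ∫ z, f (p.2.1 i + √ε • z) ∂(multivariateGaussian 0 (p.2.2 i)) := by
  have hi : ∀ i, Integrable f (multivariateGaussian (p.2.1 i) (ε • p.2.2 i)) := by
    intro i
    rw [multivariateGaussian_smul_eq_map (hp i) _ hε]
    exact (integrable_map_measure hf.aestronglyMeasurable (by fun_prop)).2 (hint i)
  have hi' : ∀ i, Integrable f (ENNReal.ofReal (p.1 i) •
      multivariateGaussian (p.2.1 i) (ε • p.2.2 i)) :=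
    fun i => (hi i).smul_measure ENNReal.ofReal_ne_top
  refine ⟨integrable_finsetSum_measure.2 fun i _ => hi' i, ?_⟩
  rw [mixture, integral_finsetSum_measure fun i _ => hi' i]
  refine Finset.sum_congr rfl fun i _ => ?_
  rw [integral_smul_measure, ENNReal.toReal_ofReal (hα i),
    multivariateGaussian_smul_eq_map (hp i) _ hε, integral_map (by fun_prop)
    hf.aestronglyMeasurable]

theorem isProbabilityMeasure_mixture {ε : ℝ} {p : Params n d} (hα : p.1 ∈ stdSimplex ℝ (Fin n)) :
    IsProbabilityMeasure (mixture ε p) := by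
  constructor
  simp only [mixture, Measure.coe_finsetSum, Measure.coe_smul, Finset.sum_apply, Pi.smul_apply,
    measure_univ, smul_eq_mul, mul_one]
  rw [← ENNReal.ofReal_sum_of_nonneg fun i _ => hα.1 i, hα.2, ENNReal.ofReal_one]

namespace Assumptions

variable {V1e : ℝ → E d → ℝ} {V1 V2 : E d → ℝ} {xe : ℝ → Fin n → E d} {x : Fin n → E d}

theorem rawWeight_pos (hV : Assumptions V1e V1 V2 xe x) (i : Fin n) :
    0 < rawWeight V1 V2 x i := by
  have := (hV.hessian_posDef i).det_pos
  unfold rawWeight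
  positivity

theorem sum_rawWeight_pos (hV : Assumptions V1e V1 V2 xe x) : 0 < ∑ j, rawWeight V1 V2 x j :=
  Finset.sum_pos (fun i _ => hV.rawWeight_pos i) ⟨⟨0, hV.n_pos⟩, Finset.mem_univ _⟩

theorem weight_pos (hV : Assumptions V1e V1 V2 xe x) (i : Fin n) : 0 < weight V1 V2 x i :=
  div_pos (hV.rawWeight_pos i) hV.sum_rawWeight_pos

theorem weight_mem_stdSimplex (hV : Assumptions V1e V1 V2 xe x) :
    weight V1 V2 x ∈ stdSimplex ℝ (Fin n) :=
  ⟨fun i => (hV.weight_pos i).le, by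
    simp only [weight]
    rw [← Finset.sum_div, div_self hV.sum_rawWeight_pos.ne']⟩

theorem exists_V2_le (hV : Assumptions V1e V1 V2 xe x) :
    ∃ M > 0, ∀ y, V2 y ≤ M * Real.exp (‖y‖ ^ 2) := by
  obtain ⟨ε₀, hε₀, M, hM, h⟩ := hV.growth
  refine ⟨M, hM, fun y => (le_abs_self _).trans ?_⟩
  simpa [partialDeriv] using (h (ε₀ / 2) (by linarith) (by linarith) y).2 0 (by norm_num) Fin.elim0

/-- `β_i φ_i(0) e^{V₂(xᵢ)}` does not depend on `i`. -/
theorem weight_mul_gaussDensity (hV : Assumptions V1e V1 V2 xe x) (i : Fin n) :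
    weight V1 V2 x i * gaussDensity (hessian V1 (x i)) 0 * Real.exp (V2 (x i)) =
      (∑ j, (gaussDensity (hessian V1 (x j)) 0)⁻¹ * Real.exp (-V2 (x j)))⁻¹ := by
  have hpi : 0 < (2 * Real.pi) ^ (-(d / 2 : ℝ)) := by have := Real.pi_pos; positivity
  have h0 : ∀ j, gaussDensity (hessian V1 (x j)) 0 =
      (2 * Real.pi) ^ (-(d / 2 : ℝ)) * √(hessian V1 (x j)).det := by
    intro j
    simp [gaussDensity, quadForm]
  have hsum : ∑ j, (gaussDensity (hessian V1 (x j)) 0)⁻¹ * Real.exp (-V2 (x j)) =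
      ((2 * Real.pi) ^ (-(d / 2 : ℝ)))⁻¹ * ∑ j, rawWeight V1 V2 x j := by
    rw [Finset.mul_sum]
    refine Finset.sum_congr rfl fun j _ => ?_
    rw [h0, rawWeight, mul_inv]
    ring
  have hdet : 0 < √(hessian V1 (x i)).det := Real.sqrt_pos.2 (hV.hessian_posDef i).det_pos
  have hS := hV.sum_rawWeight_pos
  rw [hsum, h0, weight, rawWeight, Real.exp_neg]
  generalize ∑ j, rawWeight V1 V2 x j = T at hS ⊢
  field_simp

end Assumptions

end GaussMix

/-! ### Laplace's method for the normalisation constant, and the recovery mixture -/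

namespace GaussMix

open ProbabilityTheory Matrix

variable {d n : ℕ}

theorem integrable_exp_neg_mul_norm_sq {b : ℝ} (hb : 0 < b) :
    Integrable fun z : E d => Real.exp (-(b * ‖z‖ ^ 2)) := by
  have h := (GaussianFourier.integrable_cexp_neg_mul_sq_norm_add (V := E d) (b := (b : ℂ))
    (by simpa using hb) 0 0).norm
  refine h.congr (Eventually.of_forall fun z => ?_)
  simp [Complex.norm_exp, ← Complex.ofReal_pow]

namespace Assumptions

variable {V1e : ℝ → E d → ℝ} {V1 V2 : E d → ℝ} {xe : ℝ → Fin n → E d} {x : Fin n → E d}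

theorem tendsto_xe_add_smul (hV : Assumptions V1e V1 V2 xe x) (j : Fin n) (z : E d) :
    Tendsto (fun ε => xe ε j + √ε • z) (𝓝[>] 0) (𝓝 (x j)) := by
  have h1 : Tendsto (fun ε : ℝ => √ε • z) (𝓝[>] 0) (𝓝 (√0 • z)) :=
    ((Real.continuous_sqrt.smul continuous_const).tendsto 0).mono_left nhdsWithin_le_nhds
  simpa using (hV.minimisers_tendsto j).add h1

/-- The limiting normalisation constant, in units of `ε^(d/2)`. -/
noncomputable def limitMass (V1 V2 : E d → ℝ) (x : Fin n → E d) : ℝ :=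
  ∑ j, (gaussDensity (hessian V1 (x j)) 0)⁻¹ * Real.exp (-V2 (x j))

theorem limitMass_pos (hV : Assumptions V1e V1 V2 xe x) : 0 < limitMass V1 V2 x :=
  Finset.sum_pos (fun j _ => mul_pos (inv_pos.2 (gaussDensity_pos (hV.hessian_posDef j) 0))
    (Real.exp_pos _)) ⟨⟨0, hV.n_pos⟩, Finset.mem_univ _⟩

/-- Laplace's method: an asymptotic upper bound for the normalisation constant. -/
theorem exists_normConst_le (hV : Assumptions V1e V1 V2 xe x) :
    ∃ B : ℝ → ℝ, ∃ B₀ ≤ limitMass V1 V2 x, Tendsto B (𝓝[>] 0) (𝓝 B₀) ∧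
      ∀ᶠ ε in 𝓝[>] (0 : ℝ), Integrable (fun y => Real.exp (-(1 / ε) * V1e ε y - V2 y)) ∧
        0 < normConst ε (V1e ε) V2 ∧ normConst ε (V1e ε) V2 / √ε ^ d ≤ B ε := by
  obtain ⟨c, hc, hlow⟩ := hV.exists_quadratic_lower_bound
  -- Each `g ε j` truncates the unnormalised target by a Gaussian envelope centred at `xe ε j`. By
  -- the quadratic lower bound some envelope is inactive at every point, so the target is at most
  -- the sum of the `g ε j`. This replaces a partition of space into neighbourhoods of the
  -- minimisers.
  set g : ℝ → Fin n → E d → ℝ := fun ε j y =>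
    min (Real.exp (-(1 / ε) * V1e ε y - V2 y)) (Real.exp (-(c / ε * ‖y - xe ε j‖ ^ 2))) with hg
  have hV2 : Continuous V2 := hV.V2_smooth.continuous
  have hgcont : ∀ ε > 0, ∀ j, Continuous (g ε j) := by
    intro ε hε j
    have := (hV.V1e_smooth ε hε).continuous
    fun_prop
  refine ⟨fun ε => ∑ j, ∫ z, g ε j (xe ε j + √ε • z),
    ∑ j, ∫ z, min (Real.exp (-(1 / 2 * quadForm (hessian V1 (x j)) z)) * Real.exp (-V2 (x j)))
      (Real.exp (-(c * ‖z‖ ^ 2))), ?_, ?_, ?_⟩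
  -- Discarding the envelope in the limit can only increase the integral; an inequality suffices
  -- here.
  · refine Finset.sum_le_sum fun j _ => ?_
    have hq := integral_exp_neg_quadForm (hV.hessian_posDef j)
    rw [← hq.2, ← integral_mul_const]
    refine integral_mono_of_nonneg (Eventually.of_forall fun z => ?_) (hq.1.mul_const _)
      (Eventually.of_forall fun z => min_le_left _ _)
    exact le_min (by positivity) (by positivity)
  · refine tendsto_finsetSum _ fun j _ => ?_
    refine tendsto_integral_filter_of_dominated_convergence (fun z => Real.exp (-(c * ‖z‖ ^ 2)))
      ?_ ?_ (integrable_exp_neg_mul_norm_sq hc) ?_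
    · filter_upwards [self_mem_nhdsWithin] with ε hε
      have := hgcont ε hε j
      exact Continuous.aestronglyMeasurable (by fun_prop)
    · filter_upwards [self_mem_nhdsWithin] with ε hε
      have hε' : (0 : ℝ) < ε := hε
      refine Eventually.of_forall fun z => ?_
      rw [Real.norm_of_nonneg (le_min (Real.exp_pos _).le (Real.exp_pos _).le)]
      refine (min_le_right _ _).trans (le_of_eq ?_)
      rw [add_sub_cancel_left, norm_smul, Real.norm_of_nonneg (Real.sqrt_nonneg _), mul_pow,
        Real.sq_sqrt hε'.le]
      congr 2
      field_simp
    · refine Eventually.of_forall fun z => ?_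
      have h1 := hV.tendsto_rescaled j z
      have h2 : Tendsto (fun ε => V2 (xe ε j + √ε • z)) (𝓝[>] 0) (𝓝 (V2 (x j))) :=
        (hV2.tendsto _).comp (hV.tendsto_xe_add_smul j z)
      have h3 : Tendsto (fun ε : ℝ => Real.exp (-(c / ε * ‖xe ε j + √ε • z - xe ε j‖ ^ 2)))
          (𝓝[>] 0) (𝓝 (Real.exp (-(c * ‖z‖ ^ 2)))) := by
        refine tendsto_const_nhds.congr' ?_
        filter_upwards [self_mem_nhdsWithin] with ε hε
        have hε' : (0 : ℝ) < ε := hε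
        rw [add_sub_cancel_left, norm_smul, Real.norm_of_nonneg (Real.sqrt_nonneg _), mul_pow,
          Real.sq_sqrt hε'.le]
        congr 2
        field_simp
      refine Tendsto.min ?_ h3
      rw [← Real.exp_add]
      refine (Real.continuous_exp.tendsto _).comp ?_
      rw [← sub_eq_add_neg]
      refine (h1.neg.sub h2).congr fun ε => ?_
      ring
  · filter_upwards [hlow, self_mem_nhdsWithin] with ε hε hε0
    have hε' : (0 : ℝ) < ε := hε0
    have hs : 0 < √ε := Real.sqrt_pos.2 hε'
    have hcont : Continuous fun y => Real.exp (-(1 / ε) * V1e ε y - V2 y) := by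
      have := (hV.V1e_smooth ε hε').continuous
      fun_prop
    have hgint : ∀ j, Integrable (g ε j) := by
      intro j
      refine ((integrable_exp_neg_mul_norm_sq (d := d) (div_pos hc hε')).comp_sub_right
        (xe ε j)).mono' (hgcont ε hε' j).aestronglyMeasurable (Eventually.of_forall fun y => ?_)
      rw [Real.norm_of_nonneg (le_min (Real.exp_pos _).le (Real.exp_pos _).le)]
      exact min_le_right _ _
    have hle : ∀ y, Real.exp (-(1 / ε) * V1e ε y - V2 y) ≤ ∑ j, g ε j y := by
      intro y
      obtain ⟨j, hj⟩ := hε y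
      have h1 : Real.exp (-(1 / ε) * V1e ε y - V2 y) ≤ g ε j y := by
        refine le_min le_rfl (Real.exp_le_exp.2 ?_)
        have h2 : c / ε * ‖y - xe ε j‖ ^ 2 ≤ 1 / ε * V1e ε y := by
          rw [div_mul_eq_mul_div, one_div_mul_eq_div]
          gcongr
        linarith [hV.V2_nonneg y]
      exact h1.trans (Finset.single_le_sum (f := fun j => g ε j y)
        (fun j _ => le_min (Real.exp_pos _).le (Real.exp_pos _).le) (Finset.mem_univ j))
    have hint : Integrable fun y => Real.exp (-(1 / ε) * V1e ε y - V2 y) := by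
      refine (integrable_finsetSum Finset.univ fun j _ => hgint j).mono'
        hcont.aestronglyMeasurable (Eventually.of_forall fun y => ?_)
      rw [Real.norm_of_nonneg (Real.exp_pos _).le]
      exact hle y
    refine ⟨hint, integral_exp_pos hint, ?_⟩
    have hresc : ∀ j, ∫ z, g ε j (xe ε j + √ε • z) = (√ε ^ d)⁻¹ * ∫ y, g ε j y := by
      intro j
      rw [Measure.integral_comp_smul volume (fun w => g ε j (xe ε j + w)) (√ε),
        integral_add_left_eq_self, finrank_euclideanSpace_fin, abs_of_pos (by positivity),
        smul_eq_mul]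
    simp_rw [hresc]
    rw [← Finset.mul_sum, ← integral_finsetSum _ fun j _ => hgint j, div_eq_inv_mul]
    gcongr
    exact integral_mono hint (integrable_finsetSum _ fun j _ => hgint j) hle

/-- The rescaled density of the recovery mixture. -/
noncomputable def recoveryDensity (V1 V2 : E d → ℝ) (x : Fin n → E d)
    (xe : ℝ → Fin n → E d) (ε : ℝ) (y : E d) : ℝ :=
  ∑ j, weight V1 V2 x j * gaussDensity (hessian V1 (x j)) ((√ε)⁻¹ • (y - xe ε j))

/-- The recovery sequence. -/
noncomputable def recovery (V1 V2 : E d → ℝ) (x : Fin n → E d)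
    (xe : ℝ → Fin n → E d) (ε : ℝ) : Params n d :=
  (weight V1 V2 x, xe ε, fun i => (hessian V1 (x i))⁻¹)

theorem recoveryDensity_pos (hV : Assumptions V1e V1 V2 xe x) (ε : ℝ) (y : E d) :
    0 < recoveryDensity V1 V2 x xe ε y :=
  Finset.sum_pos (fun j _ => mul_pos (hV.weight_pos j) (gaussDensity_pos (hV.hessian_posDef j) _))
    ⟨⟨0, hV.n_pos⟩, Finset.mem_univ _⟩

theorem continuous_recoveryDensity (V1 V2 : E d → ℝ) (x : Fin n → E d) (xe : ℝ → Fin n → E d)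
    (ε : ℝ) : Continuous (recoveryDensity V1 V2 x xe ε) := by
  have := fun j => continuous_gaussDensity (hessian V1 (x j))
  unfold recoveryDensity
  fun_prop

theorem recovery_mem_domain (hV : Assumptions V1e V1 V2 xe x) (ε : ℝ) :
    recovery V1 V2 x xe ε ∈ domain n d :=
  fun i => (hV.hessian_posDef i).inv.posSemidef

theorem mixture_recovery (hV : Assumptions V1e V1 V2 xe x) {ε : ℝ} (hε : 0 < ε) :
    mixture ε (recovery V1 V2 x xe ε) = volume.withDensity fun y =>
      ENNReal.ofReal ((√ε ^ d)⁻¹ * recoveryDensity V1 V2 x xe ε y) := by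
  have hs : 0 < √ε := Real.sqrt_pos.2 hε
  have hm : ∀ j, Measurable fun y => ENNReal.ofReal ((√ε ^ d)⁻¹ *
      gaussDensity (hessian V1 (x j)) ((√ε)⁻¹ • (y - xe ε j))) := by
    intro j
    have := continuous_gaussDensity (hessian V1 (x j))
    fun_prop
  have h1 : (fun y => ENNReal.ofReal ((√ε ^ d)⁻¹ * recoveryDensity V1 V2 x xe ε y)) =
      ∑ j, ENNReal.ofReal (weight V1 V2 x j) • fun y => ENNReal.ofReal ((√ε ^ d)⁻¹ *
        gaussDensity (hessian V1 (x j)) ((√ε)⁻¹ • (y - xe ε j))) := by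
    funext y
    rw [Finset.sum_apply, recoveryDensity, Finset.mul_sum, ENNReal.ofReal_sum_of_nonneg]
    · refine Finset.sum_congr rfl fun j _ => ?_
      rw [Pi.smul_apply, smul_eq_mul, ← ENNReal.ofReal_mul (hV.weight_pos j).le]
      congr 1
      ring
    · intro j _
      exact mul_nonneg (by positivity) (mul_pos (hV.weight_pos j)
        (gaussDensity_pos (hV.hessian_posDef j) _)).le
  rw [h1]
  have h2 : ∀ s : Finset (Fin n), volume.withDensity (∑ j ∈ s, ENNReal.ofReal (weight V1 V2 x j) •
      fun y => ENNReal.ofReal ((√ε ^ d)⁻¹ *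
        gaussDensity (hessian V1 (x j)) ((√ε)⁻¹ • (y - xe ε j)))) =
      ∑ j ∈ s, ENNReal.ofReal (weight V1 V2 x j) • volume.withDensity fun y =>
        ENNReal.ofReal ((√ε ^ d)⁻¹ *
          gaussDensity (hessian V1 (x j)) ((√ε)⁻¹ • (y - xe ε j))) := by
    intro s
    induction s using Finset.induction_on with
    | empty => simp
    | insert a s ha ih =>
      rw [Finset.sum_insert ha, Finset.sum_insert ha, withDensity_add_left ((hm a).const_smul _),
        withDensity_smul _ (hm a), ih]
  rw [h2]
  refine Finset.sum_congr rfl fun j _ => ?_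
  rw [recovery, multivariateGaussian_smul_inv_eq_withDensity (hV.hessian_posDef j) _ hε]

end Assumptions

end GaussMix

/-! ### The divergence of the recovery mixture tends to zero -/

namespace GaussMix

open ProbabilityTheory Matrix

variable {d n : ℕ}

namespace Assumptions

variable {V1e : ℝ → E d → ℝ} {V1 V2 : E d → ℝ} {xe : ℝ → Fin n → E d} {x : Fin n → E d}

/-- In the rescaled variable the `i`-th term does not depend on ε. The other arguments have norm of
order ‖x_i - x_j‖/√ε and escape to infinity. -/
theorem tendsto_recoveryDensity (hV : Assumptions V1e V1 V2 xe x) (i : Fin n) (z : E d) :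
    Tendsto (fun ε => recoveryDensity V1 V2 x xe ε (xe ε i + √ε • z)) (𝓝[>] 0)
      (𝓝 (weight V1 V2 x i * gaussDensity (hessian V1 (x i)) z)) := by
  have hterm : ∀ j, Tendsto (fun ε => weight V1 V2 x j *
      gaussDensity (hessian V1 (x j)) ((√ε)⁻¹ • (xe ε i + √ε • z - xe ε j))) (𝓝[>] 0)
      (𝓝 (if j = i then weight V1 V2 x i * gaussDensity (hessian V1 (x i)) z else 0)) := by
    intro j
    by_cases hj : j = i
    · subst hj
      rw [if_pos rfl]
      refine tendsto_const_nhds.congr' ?_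
      filter_upwards [self_mem_nhdsWithin] with ε hε
      have hs : 0 < √ε := Real.sqrt_pos.2 hε
      rw [add_sub_cancel_left, smul_smul, inv_mul_cancel₀ hs.ne', one_smul]
    · rw [if_neg hj]
      suffices h : Tendsto (fun ε => gaussDensity (hessian V1 (x j))
          ((√ε)⁻¹ • (xe ε i + √ε • z - xe ε j))) (𝓝[>] 0) (𝓝 0) by
        have h' := h.const_mul (weight V1 V2 x j)
        rwa [mul_zero] at h'
      refine (tendsto_gaussDensity_cobounded (hV.hessian_posDef j)).comp ?_
      rw [← tendsto_norm_atTop_iff_cobounded]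
      have h1 : Tendsto (fun ε => ‖xe ε i + √ε • z - xe ε j‖) (𝓝[>] 0) (𝓝 ‖x i - x j‖) :=
        ((hV.tendsto_xe_add_smul i z).sub (hV.minimisers_tendsto j)).norm
      have hne : 0 < ‖x i - x j‖ :=
        norm_pos_iff.2 (sub_ne_zero.2 fun h => hj (hV.minimisers_distinct h).symm)
      have h2 : Tendsto (fun ε : ℝ => (√ε)⁻¹) (𝓝[>] 0) atTop := by
        refine tendsto_inv_nhdsGT_zero.comp (tendsto_nhdsWithin_iff.2 ⟨?_, ?_⟩)
        · have := Real.continuous_sqrt.tendsto 0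
          rw [Real.sqrt_zero] at this
          exact this.mono_left nhdsWithin_le_nhds
        · filter_upwards [self_mem_nhdsWithin] with ε hε using Real.sqrt_pos.2 hε
      refine (h2.atTop_mul_pos hne h1).congr fun ε => ?_
      rw [norm_smul, norm_inv, Real.norm_of_nonneg (Real.sqrt_nonneg _)]
  have := tendsto_finsetSum Finset.univ fun j _ => hterm j
  simpa [recoveryDensity] using this

/-- For the upper bound each Gaussian density is replaced by its maximum; for the lower bound only
the `i`-th component is kept, whose logarithm is quadratic. -/
theorem abs_log_recoveryDensity_le (hV : Assumptions V1e V1 V2 xe x) (i : Fin n) :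
    ∃ K > 0, ∀ ε > 0, ∀ z, |Real.log (recoveryDensity V1 V2 x xe ε (xe ε i + √ε • z))| ≤
      K + K * ‖z‖ ^ 2 := by
  set H := fun j => hessian V1 (x j) with hH
  set w := weight V1 V2 x with hw
  have hg0 := fun j => gaussDensity_pos (hV.hessian_posDef j) 0
  set U := ∑ j, w j * gaussDensity (H j) 0 with hU
  set N := ‖fderiv ℝ (fderiv ℝ V1) (x i)‖ with hN
  refine ⟨|Real.log U| + |Real.log (w i * gaussDensity (H i) 0)| + 1 + N, by positivity,
    fun ε hε z => ?_⟩
  have hs : 0 < √ε := Real.sqrt_pos.2 hε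
  have hpos := hV.recoveryDensity_pos ε (xe ε i + √ε • z)
  have hup : Real.log (recoveryDensity V1 V2 x xe ε (xe ε i + √ε • z)) ≤ Real.log U := by
    refine Real.log_le_log hpos (Finset.sum_le_sum fun j _ => ?_)
    exact mul_le_mul_of_nonneg_left (gaussDensity_le (hV.hessian_posDef j) _) (hV.weight_pos j).le
  have hlo : w i * gaussDensity (H i) z ≤
      recoveryDensity V1 V2 x xe ε (xe ε i + √ε • z) := by
    have h1 := Finset.single_le_sum (f := fun j => weight V1 V2 x j *
      gaussDensity (hessian V1 (x j)) ((√ε)⁻¹ • (xe ε i + √ε • z - xe ε j)))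
      (fun j _ => (mul_pos (hV.weight_pos j) (gaussDensity_pos (hV.hessian_posDef j) _)).le)
      (Finset.mem_univ i)
    have h2 : (√ε)⁻¹ • (xe ε i + √ε • z - xe ε i) = z := by
      rw [add_sub_cancel_left, smul_smul, inv_mul_cancel₀ hs.ne', one_smul]
    simp only [h2] at h1
    exact h1
  have hlo' := Real.log_le_log
    (mul_pos (hV.weight_pos i) (gaussDensity_pos (hV.hessian_posDef i) z)) hlo
  have hq : quadForm (H i) z ≤ N * ‖z‖ ^ 2 := by
    rw [hH, ← fderiv_fderiv_eq_quadForm]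
    refine (le_abs_self _).trans (((_ : E d →L[ℝ] E d →L[ℝ] ℝ).le_opNorm₂ z z).trans ?_)
    rw [mul_assoc, ← sq]
  rw [Real.log_mul (hV.weight_pos i).ne' (gaussDensity_pos (hV.hessian_posDef i) z).ne',
    log_gaussDensity (hV.hessian_posDef i)] at hlo'
  have hl : Real.log (w i * gaussDensity (H i) 0) =
      Real.log (w i) + Real.log (gaussDensity (H i) 0) :=
    Real.log_mul (hV.weight_pos i).ne' (hg0 i).ne'
  have h1 := neg_abs_le (Real.log (w i * gaussDensity (H i) 0))
  have h2 := le_abs_self (Real.log U)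
  have h3 : 0 ≤ N * ‖z‖ ^ 2 := by positivity
  have h4 : 0 ≤ ‖z‖ ^ 2 := by positivity
  have h5 := abs_nonneg (Real.log U)
  have h6 := abs_nonneg (Real.log (w i * gaussDensity (H i) 0))
  have h7 := norm_nonneg (fderiv ℝ (fderiv ℝ V1) (x i))
  have h8 : N * ‖z‖ ^ 2 ≤ (|Real.log U| + |Real.log (w i * gaussDensity (H i) 0)| + 1 + N) *
      ‖z‖ ^ 2 := by gcongr; linarith
  rw [abs_le]
  constructor <;> linarith

theorem tendsto_integral_recovery (hV : Assumptions V1e V1 V2 xe x) (i : Fin n) :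
    (∀ᶠ ε in 𝓝[>] (0 : ℝ), Integrable (fun z =>
      Real.log (recoveryDensity V1 V2 x xe ε (xe ε i + √ε • z)) + V1e ε (xe ε i + √ε • z) / ε +
        V2 (xe ε i + √ε • z)) (multivariateGaussian 0 (hessian V1 (x i))⁻¹)) ∧
    Tendsto (fun ε => ∫ z, Real.log (recoveryDensity V1 V2 x xe ε (xe ε i + √ε • z)) +
        V1e ε (xe ε i + √ε • z) / ε + V2 (xe ε i + √ε • z)
        ∂(multivariateGaussian 0 (hessian V1 (x i))⁻¹)) (𝓝[>] 0)
      (𝓝 (-Real.log (limitMass V1 V2 x))) := by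
  set γ := multivariateGaussian (0 : E d) (hessian V1 (x i))⁻¹ with hγ
  -- Fernique's theorem provides the dominating function exp(a‖z‖²). For ε < a/4, the factor
  -- exp(2ε‖z‖²) produced by the growth bounds uses at most half of the exponent, and the other half
  -- absorbs ‖z‖².
  obtain ⟨a, ha, hint⟩ := IsGaussian.exists_integrable_exp_sq γ
  obtain ⟨K, hK, hlog⟩ := hV.abs_log_recoveryDensity_le i
  obtain ⟨C, hC, hVup⟩ := hV.exists_le_sq_mul_exp
  obtain ⟨M, hM, hV2⟩ := hV.exists_V2_le
  have hV2c : Continuous V2 := hV.V2_smooth.continuous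
  set D := K + K * (2 / a) + C * (2 / a) + M * Real.exp (2 * (‖x i‖ + 1) ^ 2) with hD
  have hmeas : ∀ ε > 0, AEStronglyMeasurable (fun z =>
      Real.log (recoveryDensity V1 V2 x xe ε (xe ε i + √ε • z)) + V1e ε (xe ε i + √ε • z) / ε +
        V2 (xe ε i + √ε • z)) γ := by
    intro ε hε
    have h1 := (hV.V1e_smooth ε hε).continuous
    have h2 := (continuous_recoveryDensity V1 V2 x xe ε).log
      fun y => (hV.recoveryDensity_pos ε y).ne'
    have h3 : Continuous fun z : E d => xe ε i + √ε • z := by fun_prop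
    exact (((h2.comp h3).add ((h1.comp h3).div_const ε)).add
      (hV2c.comp h3)).aestronglyMeasurable
  have hbound : ∀ᶠ ε in 𝓝[>] (0 : ℝ), ∀ z,
      ‖Real.log (recoveryDensity V1 V2 x xe ε (xe ε i + √ε • z)) + V1e ε (xe ε i + √ε • z) / ε +
        V2 (xe ε i + √ε • z)‖ ≤ D * Real.exp (a * ‖z‖ ^ 2) := by
    filter_upwards [hVup, hV.eventually_norm_xe_le i,
      Ioo_mem_nhdsGT (show (0 : ℝ) < a / 4 by positivity)] with ε hup hxe hε z
    have hε0 := hε.1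
    have hsq : ‖√ε • z‖ ^ 2 = ε * ‖z‖ ^ 2 := by
      rw [norm_smul, Real.norm_of_nonneg (Real.sqrt_nonneg _), mul_pow, Real.sq_sqrt hε0.le]
    set t := ‖z‖ ^ 2 with ht
    have ht0 : 0 ≤ t := by positivity
    have he1 : 1 ≤ Real.exp (a * t) := Real.one_le_exp (by positivity)
    have he2 : Real.exp (a / 2 * t) * Real.exp (a / 2 * t) = Real.exp (a * t) := by
      rw [← Real.exp_add]; congr 1; ring
    have he3 : Real.exp (a / 2 * t) ≤ Real.exp (a * t) :=
      Real.exp_le_exp.2 (by nlinarith)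
    have ht1 : t ≤ 2 / a * Real.exp (a / 2 * t) := by
      have := Real.add_one_le_exp (a / 2 * t)
      rw [div_mul_eq_mul_div, le_div_iff₀ ha]
      linarith
    have heε : Real.exp (2 * (ε * t)) ≤ Real.exp (a / 2 * t) :=
      Real.exp_le_exp.2 (by nlinarith [hε.2])
    have b1 : |Real.log (recoveryDensity V1 V2 x xe ε (xe ε i + √ε • z))| ≤
        (K + K * (2 / a)) * Real.exp (a * t) := by
      refine (hlog ε hε0 z).trans ?_
      calc K + K * t ≤ K * Real.exp (a * t) + K * (2 / a * Real.exp (a * t)) := by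
            gcongr
            · exact le_mul_of_one_le_right hK.le he1
            · exact ht1.trans (by gcongr)
        _ = _ := by ring
    have b2 : V1e ε (xe ε i + √ε • z) / ε ≤ C * (2 / a) * Real.exp (a * t) := by
      rw [div_le_iff₀ hε0]
      refine (hup i (√ε • z)).trans ?_
      rw [hsq]
      calc C * (ε * t) * Real.exp (2 * (ε * t))
          ≤ C * (ε * (2 / a * Real.exp (a / 2 * t))) * Real.exp (a / 2 * t) := by gcongr
        _ = C * (2 / a) * (Real.exp (a / 2 * t) * Real.exp (a / 2 * t)) * ε := by ring
        _ = _ := by rw [he2]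
    have b3 : V2 (xe ε i + √ε • z) ≤ M * Real.exp (2 * (‖x i‖ + 1) ^ 2) * Real.exp (a * t) := by
      refine (hV2 _).trans ?_
      rw [mul_assoc, ← Real.exp_add]
      have h1 : ‖xe ε i + √ε • z‖ ≤ (‖x i‖ + 1) + ‖√ε • z‖ := by
        have h1 := norm_add_le (xe ε i) (√ε • z)
        have h2 := norm_le_norm_add_norm_sub' (xe ε i) (x i)
        linarith
      have h2 : ‖xe ε i + √ε • z‖ ^ 2 ≤ 2 * (‖x i‖ + 1) ^ 2 + 2 * ‖√ε • z‖ ^ 2 := by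
        calc _ ≤ ((‖x i‖ + 1) + ‖√ε • z‖) ^ 2 := by gcongr
          _ ≤ _ := by nlinarith [sq_nonneg (‖x i‖ + 1 - ‖√ε • z‖)]
      rw [hsq] at h2
      gcongr
      nlinarith [hε.2]
    have p2 : 0 ≤ V1e ε (xe ε i + √ε • z) / ε := div_nonneg (hV.V1e_nonneg ε hε0 _) hε0.le
    have p3 := hV.V2_nonneg (xe ε i + √ε • z)
    rw [Real.norm_eq_abs]
    calc _ ≤ |Real.log (recoveryDensity V1 V2 x xe ε (xe ε i + √ε • z))| +
          V1e ε (xe ε i + √ε • z) / ε + V2 (xe ε i + √ε • z) := by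
          refine (abs_add_three _ _ _).trans ?_
          rw [abs_of_nonneg p2, abs_of_nonneg p3]
      _ ≤ _ := by
          rw [hD]
          linarith
  refine ⟨?_, ?_⟩
  · filter_upwards [hbound, self_mem_nhdsWithin] with ε hε hε0
    exact (hint.const_mul D).mono' (hmeas ε hε0) (Eventually.of_forall hε)
  have hlim : -Real.log (limitMass V1 V2 x) = ∫ _, -Real.log (limitMass V1 V2 x) ∂γ := by simp
  rw [hlim]
  refine tendsto_integral_filter_of_dominated_convergence _ ?_
    (hbound.mono fun ε hε => Eventually.of_forall hε) (hint.const_mul D)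
    (Eventually.of_forall fun z => ?_)
  · filter_upwards [self_mem_nhdsWithin] with ε hε using hmeas ε hε
  · have hw := hV.weight_pos i
    have hg := gaussDensity_pos (hV.hessian_posDef i)
    have h1 := (hV.tendsto_recoveryDensity i z).log (mul_pos hw (hg z)).ne'
    have h2 := hV.tendsto_rescaled i z
    have h3 : Tendsto (fun ε => V2 (xe ε i + √ε • z)) (𝓝[>] 0) (𝓝 (V2 (x i))) :=
      (hV2c.tendsto _).comp (hV.tendsto_xe_add_smul i z)
    have h4 := congrArg Real.log (hV.weight_mul_gaussDensity i)
    rw [Real.log_inv, Real.log_mul (mul_pos hw (hg 0)).ne' (Real.exp_pos _).ne', Real.log_exp,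
      Real.log_mul hw.ne' (hg 0).ne'] at h4
    -- The quadratic form in the Gaussian logarithm cancels the limit of V₁^ε/ε, so the limit is
    -- constant in `z`; `weight_mul_gaussDensity` makes it independent of `i`.
    have h5 : -Real.log (limitMass V1 V2 x) =
        Real.log (weight V1 V2 x i * gaussDensity (hessian V1 (x i)) z) +
          1 / 2 * quadForm (hessian V1 (x i)) z + V2 (x i) := by
      rw [limitMass, ← h4, Real.log_mul hw.ne' (hg z).ne', log_gaussDensity (hV.hessian_posDef i) z]
      ring
    rw [h5]
    exact (h1.add h2).add h3

theorem isProbabilityMeasure_target (hV : Assumptions V1e V1 V2 xe x) :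
    ∀ᶠ ε in 𝓝[>] (0 : ℝ), IsProbabilityMeasure (target ε (V1e ε) V2) := by
  obtain ⟨B, B₀, -, -, h⟩ := hV.exists_normConst_le
  filter_upwards [h] with ε ⟨hint, hpos, _⟩
  constructor
  rw [target, withDensity_apply _ MeasurableSet.univ, Measure.restrict_univ,
    ← ofReal_integral_eq_lintegral_ofReal (hint.div_const _)
      (Eventually.of_forall fun y => div_nonneg (Real.exp_pos _).le hpos.le),
    integral_div]
  change ENNReal.ofReal (normConst ε (V1e ε) V2 / normConst ε (V1e ε) V2) = 1
  rw [div_self hpos.ne', ENNReal.ofReal_one]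

theorem tendsto_klDiv_recovery (hV : Assumptions V1e V1 V2 xe x) :
    Tendsto (fun ε => InformationTheory.klDiv (mixture ε (recovery V1 V2 x xe ε))
      (target ε (V1e ε) V2)) (𝓝[>] 0) (𝓝 0) := by
  obtain ⟨B, B₀, hB₀, hB, hZ⟩ := hV.exists_normConst_le
  have hS := hV.limitMass_pos
  set S := limitMass V1 V2 x with hSdef
  set I : ℝ → Fin n → ℝ := fun ε i => ∫ z,
    Real.log (recoveryDensity V1 V2 x xe ε (xe ε i + √ε • z)) +
        V1e ε (xe ε i + √ε • z) / ε + V2 (xe ε i + √ε • z)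
        ∂(multivariateGaussian 0 (hessian V1 (x i))⁻¹) with hI
  -- The logarithm of Z/ε^(d/2) is linearised around S by log r ≤ log S + r/S - 1. Then `B` enters
  -- linearly, and `B₀ ≤ S` alone yields a limit at most 0.
  have hlim : Tendsto (fun ε => ENNReal.ofReal
      (∑ i, weight V1 V2 x i * I ε i + (Real.log S + B ε / S - 1))) (𝓝[>] 0) (𝓝 0) := by
    have h1 : Tendsto (fun ε => ∑ i, weight V1 V2 x i * I ε i + (Real.log S + B ε / S - 1))
        (𝓝[>] 0) (𝓝 (∑ i, weight V1 V2 x i * (-Real.log S) + (Real.log S + B₀ / S - 1))) :=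
      (tendsto_finsetSum _ fun i _ => (hV.tendsto_integral_recovery i).2.const_mul _).add
        (((hB.div_const S).const_add _).sub_const 1)
    have h2 : ∑ i, weight V1 V2 x i * (-Real.log S) + (Real.log S + B₀ / S - 1) ≤ 0 := by
      rw [← Finset.sum_mul, hV.weight_mem_stdSimplex.2]
      have : B₀ / S ≤ 1 := (div_le_one hS).2 hB₀
      linarith
    have h3 := ENNReal.tendsto_ofReal h1
    rwa [ENNReal.ofReal_of_nonpos h2] at h3
  refine tendsto_of_tendsto_of_tendsto_of_le_of_le' tendsto_const_nhds hlim
    (Eventually.of_forall fun _ => zero_le) ?_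
  filter_upwards [hZ, eventually_all.2 fun i => (hV.tendsto_integral_recovery i).1,
    hV.isProbabilityMeasure_target, self_mem_nhdsWithin] with ε ⟨_, hZpos, hZle⟩ hint hprob hε0
  have hε : (0 : ℝ) < ε := hε0
  have hs : 0 < √ε := Real.sqrt_pos.2 hε
  set Z := normConst ε (V1e ε) V2 with hZdef
  have hVc := (hV.V1e_smooth ε hε).continuous
  have hV2c : Continuous V2 := hV.V2_smooth.continuous
  have hrc := continuous_recoveryDensity V1 V2 x xe ε
  have hrpos := hV.recoveryDensity_pos ε
  have hprobP : IsProbabilityMeasure (mixture ε (recovery V1 V2 x xe ε)) :=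
    isProbabilityMeasure_mixture hV.weight_mem_stdSimplex
  have hlogeq : ∀ y, Real.log ((√ε ^ d)⁻¹ * recoveryDensity V1 V2 x xe ε y) -
      Real.log (Real.exp (-(1 / ε) * V1e ε y - V2 y) / Z) =
      Real.log (recoveryDensity V1 V2 x xe ε y) + V1e ε y / ε + V2 y +
        Real.log (Z / √ε ^ d) := by
    intro y
    rw [Real.log_mul (by positivity) (hrpos y).ne', Real.log_div (Real.exp_pos _).ne' hZpos.ne',
      Real.log_exp, Real.log_div hZpos.ne' (by positivity), Real.log_inv]
    ring
  have hmain := integral_mixture hε.le (hV.recovery_mem_domain ε)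
    (fun i => (hV.weight_pos i).le) (f := fun y => Real.log (recoveryDensity V1 V2 x xe ε y) +
      V1e ε y / ε + V2 y)
    ((((hrc.log fun y => (hrpos y).ne').add (hVc.div_const ε)).add hV2c).stronglyMeasurable) hint
  have hintP : Integrable (fun y => Real.log ((√ε ^ d)⁻¹ * recoveryDensity V1 V2 x xe ε y) -
      Real.log (Real.exp (-(1 / ε) * V1e ε y - V2 y) / Z))
      (mixture ε (recovery V1 V2 x xe ε)) := by
    simp_rw [hlogeq]
    exact hmain.1.add (integrable_const _)
  have hval : ∫ y, Real.log ((√ε ^ d)⁻¹ * recoveryDensity V1 V2 x xe ε y) -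
      Real.log (Real.exp (-(1 / ε) * V1e ε y - V2 y) / Z)
      ∂(mixture ε (recovery V1 V2 x xe ε)) =
      ∑ i, weight V1 V2 x i * I ε i + Real.log (Z / √ε ^ d) := by
    simp_rw [hlogeq]
    rw [integral_add hmain.1 (integrable_const _), hmain.2, integral_const, probReal_univ, one_smul]
    rfl
  have hkl : InformationTheory.klDiv (mixture ε (recovery V1 V2 x xe ε)) (target ε (V1e ε) V2) =
      ENNReal.ofReal (∑ i, weight V1 V2 x i * I ε i + Real.log (Z / √ε ^ d)) := by
    have hprobQ : IsProbabilityMeasure (volume.withDensity fun y =>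
        ENNReal.ofReal (Real.exp (-(1 / ε) * V1e ε y - V2 y) / Z)) := hprob
    rw [← hval]
    rw [hV.mixture_recovery hε] at hintP hprobP ⊢
    exact klDiv_withDensity_eq (by fun_prop) (by fun_prop)
      (fun y => mul_pos (by positivity) (hrpos y))
      (fun y => div_pos (Real.exp_pos _) hZpos) hintP
  rw [hkl]
  refine ENNReal.ofReal_le_ofReal ?_
  have hr : 0 < Z / √ε ^ d := by positivity
  have h1 := Real.log_le_sub_one_of_pos (div_pos hr hS)
  rw [Real.log_div hr.ne' hS.ne'] at h1
  have h2 : Z / √ε ^ d / S ≤ B ε / S := by gcongr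
  linarith

end Assumptions

end GaussMix

/-! ### A Pinsker type inequality, and bounds for Gaussian parameters -/

namespace GaussMix

open ProbabilityTheory Matrix InformationTheory

/-- With t = s² and log s ≥ 1 - 1/s, the function t log t + 1 - t is at least 2(s² - s) + 1 - s² =
(s - 1)². -/
theorem sq_sqrt_sub_one_le_klFun {t : ℝ} (ht : 0 ≤ t) : (√t - 1) ^ 2 ≤ klFun t := by
  rcases ht.eq_or_lt with rfl | ht
  · simp [klFun_zero]
  obtain ⟨s, hs, rfl⟩ : ∃ s > 0, t = s ^ 2 := ⟨√t, Real.sqrt_pos.2 ht, (Real.sq_sqrt ht.le).symm⟩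
  have h := Real.one_sub_inv_le_log_of_pos hs
  have h' : s ^ 2 * (1 - s⁻¹) ≤ s ^ 2 * Real.log s := by gcongr
  have h'' : s ^ 2 * (1 - s⁻¹) = s ^ 2 - s := by field_simp
  rw [Real.sqrt_sq hs.le, klFun_apply, Real.log_pow]
  push_cast
  nlinarith

/-- Weighted arithmetic-geometric mean inequality for |t - 1| = |√t - 1|(√t + 1), with (√t + 1)² ≤
2(t + 1). The free parameter `c` lets the bound be integrated term by term, without Cauchy–Schwarz.
-/
theorem abs_sub_one_le_klFun {t c : ℝ} (ht : 0 ≤ t) (hc : 0 < c) :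
    |t - 1| ≤ c / 2 * klFun t + (t + 1) / c := by
  have h := sq_sqrt_sub_one_le_klFun ht
  obtain ⟨s, hs, rfl⟩ : ∃ s, 0 ≤ s ∧ t = s ^ 2 := ⟨√t, Real.sqrt_nonneg _, (Real.sq_sqrt ht).symm⟩
  rw [Real.sqrt_sq hs] at h
  have h1 : |s ^ 2 - 1| * c ≤ c ^ 2 / 2 * (s - 1) ^ 2 + (s + 1) ^ 2 / 2 := by
    rw [show s ^ 2 - 1 = (s - 1) * (s + 1) by ring, abs_mul,
      abs_of_nonneg (by linarith : 0 ≤ s + 1)]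
    nlinarith [sq_nonneg (c * |s - 1| - (s + 1)), sq_abs (s - 1)]
  rw [← le_div_iff₀ hc] at h1
  refine h1.trans ?_
  have h2 : (s + 1) ^ 2 / 2 ≤ s ^ 2 + 1 := by nlinarith [sq_nonneg (s - 1)]
  rw [add_div]
  have h3 : c ^ 2 / 2 * (s - 1) ^ 2 / c = c / 2 * (s - 1) ^ 2 := by field_simp
  rw [h3]
  gcongr

section TotalVariation

variable {X F : Type*} [MeasurableSpace X] [NormedAddCommGroup F] [NormedSpace ℝ F]

/-- A Pinsker type inequality, in a form suited to limits. -/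
theorem norm_integral_sub_le_of_klDiv {P Q : Measure X} [IsProbabilityMeasure P]
    [IsProbabilityMeasure Q] (hfin : klDiv P Q ≠ ∞) {f : X → F} (hf : StronglyMeasurable f)
    (hf1 : ∀ y, ‖f y‖ ≤ 1) {c : ℝ} (hc : 0 < c) :
    ‖∫ y, f y ∂P - ∫ y, f y ∂Q‖ ≤ c / 2 * (klDiv P Q).toReal + 2 / c := by
  obtain ⟨hac, hllr⟩ := klDiv_ne_top_iff.1 hfin
  set g := fun y => (P.rnDeriv Q y).toReal with hg
  have hgint : Integrable g Q := Measure.integrable_toReal_rnDeriv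
  have hg0 : ∀ y, 0 ≤ g y := fun y => ENNReal.toReal_nonneg
  have hg1 : ∫ y, g y ∂Q = 1 := by
    rw [hg, Measure.integral_toReal_rnDeriv hac, probReal_univ]
  have hkl : Integrable (fun y => klFun (g y)) Q := (integrable_klFun_rnDeriv_iff hac).2 hllr
  have hfQ : Integrable f Q :=
    Integrable.of_bound hf.aestronglyMeasurable 1 (Eventually.of_forall hf1)
  have hgf : Integrable (fun y => g y • f y) Q :=
    hgint.smul_bdd 1 hf.aestronglyMeasurable (Eventually.of_forall hf1)
  have h1 : ∫ y, f y ∂P - ∫ y, f y ∂Q = ∫ y, (g y - 1) • f y ∂Q := by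
    rw [← integral_rnDeriv_smul hac, ← integral_sub hgf hfQ]
    simp [sub_smul, hg]
  rw [h1]
  have hg2 : Integrable (fun y => (g y + 1) / c) Q := (hgint.add (integrable_const 1)).div_const c
  have hb : Integrable (fun y => c / 2 * klFun (g y) + (g y + 1) / c) Q :=
    (hkl.const_mul _).add hg2
  refine (norm_integral_le_of_norm_le hb (Eventually.of_forall fun y => ?_)).trans (le_of_eq ?_)
  · rw [norm_smul]
    exact (mul_le_of_le_one_right (norm_nonneg _) (hf1 y)).trans
      (abs_sub_one_le_klFun (hg0 y) hc)
  · rw [integral_add (hkl.const_mul _) hg2,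
      integral_const_mul, integral_div, integral_add hgint (integrable_const 1), hg1,
      ← toReal_klDiv_eq_integral_klFun hac]
    simp
    norm_num

/-- The test functions may vary with the index. This is essential, since they will concentrate at
scale √ε. -/
theorem tendsto_integral_sub_of_klDiv {ι : Type*} {l : Filter ι} {P Q : ι → Measure X}
    (hP : ∀ᶠ i in l, IsProbabilityMeasure (P i)) (hQ : ∀ᶠ i in l, IsProbabilityMeasure (Q i))
    (h : Tendsto (fun i => klDiv (P i) (Q i)) l (𝓝 0)) {f : ι → X → F}
    (hf : ∀ i, StronglyMeasurable (f i)) (hf1 : ∀ i y, ‖f i y‖ ≤ 1) :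
    Tendsto (fun i => ∫ y, f i y ∂(P i) - ∫ y, f i y ∂(Q i)) l (𝓝 0) := by
  rw [Metric.tendsto_nhds]
  intro δ hδ
  -- With c = 4/δ the constant term is δ/2, while the divergence term vanishes in the limit.
  have hK : Tendsto (fun i => (4 / δ) / 2 * (klDiv (P i) (Q i)).toReal + 2 / (4 / δ)) l
      (𝓝 ((4 / δ) / 2 * 0 + 2 / (4 / δ))) :=
    (((ENNReal.tendsto_toReal ENNReal.zero_ne_top).comp h).const_mul _).add_const _
  have hlt : (4 / δ) / 2 * 0 + 2 / (4 / δ) < δ := by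
    field_simp
    nlinarith [pow_pos hδ 2]
  filter_upwards [hP, hQ, h.eventually_ne ENNReal.zero_ne_top, hK.eventually_lt_const hlt]
    with i hPi hQi hne hi
  rw [dist_zero_right]
  exact (norm_integral_sub_le_of_klDiv hne (hf i) (hf1 i) (by positivity)).trans_lt hi

end TotalVariation

variable {d : ℕ}

theorem integrable_sq_norm_multivariateGaussian (w : E d) (S : Matrix (Fin d) (Fin d) ℝ) :
    Integrable (fun z => ‖z‖ ^ 2) (multivariateGaussian w S) := by
  have := (IsGaussian.memLp_two_id (μ := multivariateGaussian w S)).norm.integrable_sq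
  simpa using this

theorem integral_sq_norm_multivariateGaussian {S : Matrix (Fin d) (Fin d) ℝ} (hS : S.PosSemidef)
    (w : E d) : ∫ z, ‖z‖ ^ 2 ∂(multivariateGaussian w S) = ‖w‖ ^ 2 + S.trace := by
  have hcoord : ∀ i, MemLp (fun z : E d => z i) 2 (multivariateGaussian w S) := by
    intro i
    have := (EuclideanSpace.proj (𝕜 := ℝ) i).comp_memLp'
      (IsGaussian.memLp_two_id (μ := multivariateGaussian w S))
    exact this
  have h1 : ∀ i, ∫ z : E d, z i ^ 2 ∂(multivariateGaussian w S) = w i ^ 2 + S i i := by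
    intro i
    have hm : ∫ z : E d, z i ∂(multivariateGaussian w S) = w i := by
      have := (measurePreserving_eval_multivariateGaussian (μ := w) hS (i := i)).map_eq
      have h2 : ∫ t, t ∂((multivariateGaussian w S).map fun z : E d => z i) = w i := by
        rw [this, integral_id_gaussianReal]
      rwa [integral_map (by fun_prop) (by fun_prop)] at h2
    have hv := variance_eval_multivariateGaussian (μ := w) hS i
    rw [variance_eq_sub (hcoord i), hm] at hv
    simp only [Pi.pow_apply] at hv
    linarith
  simp_rw [EuclideanSpace.real_norm_sq_eq]
  rw [integral_finsetSum _ fun i _ => (hcoord i).integrable_sq]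
  simp_rw [h1]
  rw [Finset.sum_add_distrib]
  rfl

theorem multivariateGaussian_real_tail_le {S : Matrix (Fin d) (Fin d) ℝ} (hS : S.PosSemidef)
    (w : E d) {r : ℝ} (hr : 0 < r) :
    (multivariateGaussian w S).real {z | r ≤ ‖z‖} ≤ (‖w‖ ^ 2 + S.trace) / r ^ 2 := by
  have h := mul_meas_ge_le_integral_of_nonneg (μ := multivariateGaussian w S)
    (Eventually.of_forall fun z => sq_nonneg ‖z‖) (integrable_sq_norm_multivariateGaussian w S)
    (r ^ 2)
  rw [integral_sq_norm_multivariateGaussian hS] at h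
  rw [le_div_iff₀ (by positivity), mul_comm]
  have hset : {z : E d | r ≤ ‖z‖} = {z | r ^ 2 ≤ ‖z‖ ^ 2} := by
    ext z
    exact (pow_le_pow_iff_left₀ hr.le (norm_nonneg _) two_ne_zero).symm
  rwa [hset]

open scoped NNReal in
-- The density is at most (2πv)^(-1/2), so a large variance leaves too little mass in the interval.
-- Once the variance is bounded, Chebyshev's inequality excludes a distant mean. The bounds also
-- cover the Dirac case v = 0.
theorem gaussianReal_bounds {a : ℝ} {v : ℝ≥0} {R p : ℝ} (hR : 0 < R) (hp : 0 < p)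
    (h : p ≤ (gaussianReal a v).real (Set.Icc (-R) R)) :
    (v : ℝ) ≤ (2 * R / p) ^ 2 ∧ |a| ≤ R + √((2 * R / p) ^ 2 / p) := by
  have hv : (v : ℝ) ≤ (2 * R / p) ^ 2 := by
    by_cases hv : v = 0
    · rw [hv]
      simp
      positivity
    have hv0 : 0 < (v : ℝ) := by positivity
    have hpi := Real.pi_gt_three
    have hle : (gaussianReal a v).real (Set.Icc (-R) R) ≤ (√(2 * Real.pi * v))⁻¹ * (2 * R) := by
      rw [Measure.real, gaussianReal_apply_eq_integral a hv, ENNReal.toReal_ofReal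
        (setIntegral_nonneg measurableSet_Icc fun x _ => gaussianPDFReal_nonneg a v x)]
      calc ∫ x in Set.Icc (-R) R, gaussianPDFReal a v x
          ≤ ∫ x in Set.Icc (-R) R, (√(2 * Real.pi * v))⁻¹ := by
            refine setIntegral_mono_on (integrable_gaussianPDFReal a v).integrableOn
              (integrableOn_const (by simp)) measurableSet_Icc fun x _ => ?_
            rw [gaussianPDFReal]
            refine mul_le_of_le_one_right (by positivity) (Real.exp_le_one_iff.2 ?_)
            rw [neg_div]
            exact neg_nonpos.2 (by positivity)
        _ = _ := by
            simp [Measure.real, hR.le]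
            ring
    have hs : 0 < √(2 * Real.pi * v) := by positivity
    have h1 := h.trans hle
    rw [inv_mul_eq_div, le_div_iff₀ hs, mul_comm, ← le_div_iff₀ hp] at h1
    have h2 := pow_le_pow_left₀ hs.le h1 2
    rw [Real.sq_sqrt (by positivity)] at h2
    nlinarith
  refine ⟨hv, ?_⟩
  by_contra! hcon
  have hpos : 0 < |a| - R := by linarith [Real.sqrt_nonneg ((2 * R / p) ^ 2 / p)]
  have hch := meas_ge_le_variance_div_sq (μ := gaussianReal a v) (X := id)
    (IsGaussian.memLp_two_id) hpos
  rw [variance_id_gaussianReal] at hch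
  have hsub : Set.Icc (-R) R ⊆ {x | |a| - R ≤ |id x - ∫ y, id y ∂(gaussianReal a v)|} := by
    intro x hx
    have h2 : |x| ≤ R := abs_le.2 hx
    have h3 := abs_sub_abs_le_abs_sub a x
    simp only [id, integral_id_gaussianReal, Set.mem_ofPred_eq]
    rw [abs_sub_comm]
    linarith
  have h2 : p ≤ v / (|a| - R) ^ 2 := by
    refine h.trans ?_
    rw [Measure.real]
    refine ENNReal.toReal_le_of_le_ofReal (by positivity) ((measure_mono hsub).trans hch)
  rw [le_div_iff₀ (by positivity)] at h2
  have h3 : √((2 * R / p) ^ 2 / p) < |a| - R := by linarith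
  rw [Real.sqrt_lt' hpos, div_lt_iff₀ hp] at h3
  linarith

theorem multivariateGaussian_bounds {S : Matrix (Fin d) (Fin d) ℝ} (hS : S.PosSemidef) {w : E d}
    {R p : ℝ} (hR : 0 < R) (hp : 0 < p)
    (h : p ≤ (multivariateGaussian w S).real (Metric.closedBall 0 R)) (i : Fin d) :
    S i i ≤ (2 * R / p) ^ 2 ∧ |w i| ≤ R + √((2 * R / p) ^ 2 / p) := by
  have hmp := measurePreserving_eval_multivariateGaussian (μ := w) hS (i := i)
  have hle : (multivariateGaussian w S).real (Metric.closedBall 0 R) ≤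
      (gaussianReal (w i) (S i i).toNNReal).real (Set.Icc (-R) R) := by
    rw [← hmp.measureReal_preimage measurableSet_Icc.nullMeasurableSet]
    refine measureReal_mono fun z hz => ?_
    have h1 : |z i| ≤ ‖z‖ := by simpa using PiLp.norm_apply_le z i
    exact abs_le.1 (h1.trans (by simpa using hz))
  have := gaussianReal_bounds hR hp (h.trans hle)
  rwa [Real.coe_toNNReal _ (hS.diag_nonneg)] at this

/-- Non-negativity of the form at e_i ± e_j gives 2|S_ij| ≤ S_ii + S_jj. -/
theorem abs_apply_le_of_posSemidef {S : Matrix (Fin d) (Fin d) ℝ} (hS : S.PosSemidef) {B : ℝ}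
    (hB : ∀ i, S i i ≤ B) (i j : Fin d) : |S i j| ≤ B := by
  have hsymm : S j i = S i j := by simpa using hS.isHermitian.apply i j
  have h1 := quadForm_nonneg hS (EuclideanSpace.single i 1 + EuclideanSpace.single j 1)
  have h2 := quadForm_nonneg hS (EuclideanSpace.single i 1 - EuclideanSpace.single j 1)
  simp [quadForm, mulVec_add, mulVec_sub, hsymm] at h1 h2
  have h3 := hB i
  have h4 := hB j
  rw [abs_le]
  constructor <;> linarith

/-- Polarisation; Hermitian matrices are required because the form sees only the symmetric part. -/
theorem eq_of_quadForm_eq {S T : Matrix (Fin d) (Fin d) ℝ} (hS : S.IsHermitian)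
    (hT : T.IsHermitian) (h : ∀ z, quadForm S z = quadForm T z) : S = T := by
  ext i j
  have hS' : S j i = S i j := by simpa using hS.apply i j
  have hT' : T j i = T i j := by simpa using hT.apply i j
  have h1 := h (EuclideanSpace.single i 1 + EuclideanSpace.single j 1)
  have h2 := h (EuclideanSpace.single i 1)
  have h3 := h (EuclideanSpace.single j 1)
  simp [quadForm, mulVec_add, hS', hT'] at h1 h2 h3
  linarith

end GaussMix

/-! ### Localised characters and concentrating mixtures -/

namespace GaussMix

open ProbabilityTheory Matrix

variable {d n : ℕ}

theorem norm_integral_le_measureReal {X F : Type*} [MeasurableSpace X] [NormedAddCommGroup F]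
    [NormedSpace ℝ F] {μ : Measure X} [IsFiniteMeasure μ] {g : X → F} {A : Set X}
    (hA : MeasurableSet A) (h1 : ∀ z, ‖g z‖ ≤ 1) (h0 : ∀ z ∉ A, g z = 0) :
    ‖∫ z, g z ∂μ‖ ≤ μ.real A := by
  rw [← integral_indicator_one hA]
  refine norm_integral_le_of_norm_le ((integrable_const (1 : ℝ)).indicator hA)
    (Eventually.of_forall fun z => ?_)
  by_cases hz : z ∈ A
  · rw [Set.indicator_of_mem hz]
    exact h1 z
  · rw [Set.indicator_of_notMem hz, h0 z hz, norm_zero]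

/-- A character at scale `s` around `c`, cut off outside of the ball of radius `r`. -/
noncomputable def localChar (c : E d) (r s : ℝ) (t : E d) : E d → ℂ :=
  (Metric.closedBall c r).indicator fun y => Complex.exp (inner ℝ (s⁻¹ • (y - c)) t * Complex.I)

theorem norm_cexp_ofReal_mul_I_le (a : ℝ) : ‖Complex.exp (a * Complex.I)‖ ≤ 1 :=
  (Complex.norm_exp_ofReal_mul_I a).le

theorem norm_localChar_le (c : E d) (r s : ℝ) (t y : E d) : ‖localChar c r s t y‖ ≤ 1 := by
  unfold localChar
  by_cases hy : y ∈ Metric.closedBall c r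
  · rw [Set.indicator_of_mem hy]
    exact norm_cexp_ofReal_mul_I_le _
  · rw [Set.indicator_of_notMem hy]
    simp

theorem stronglyMeasurable_localChar (c : E d) (r s : ℝ) (t : E d) :
    StronglyMeasurable (localChar c r s t) :=
  (Continuous.stronglyMeasurable (by fun_prop)).indicator Metric.isClosed_closedBall.measurableSet

theorem multivariateGaussian_eq_map_rescaled {S : Matrix (Fin d) (Fin d) ℝ} (hS : S.PosSemidef)
    (c w : E d) {ε : ℝ} (hε : 0 ≤ ε) :
    multivariateGaussian (c + √ε • w) (ε • S) =
      (multivariateGaussian w S).map (fun z => c + √ε • z) := by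
  rw [map_affine_multivariateGaussian hS, Real.sq_sqrt hε]

/-- Chebyshev's inequality at radius r/√ε bounds the tail by ε(‖w‖² + tr S)/r², and the second
moments converge. -/
theorem tendsto_rescaled_tail {l : Filter ℝ} (hl : l ≤ 𝓝[>] 0) {w : ℝ → E d}
    {S : ℝ → Matrix (Fin d) (Fin d) ℝ} {w₀ : E d} {S₀ : Matrix (Fin d) (Fin d) ℝ}
    (hS : ∀ᶠ ε in l, (S ε).PosSemidef) (hw : Tendsto w l (𝓝 w₀)) (hS₀ : Tendsto S l (𝓝 S₀))
    {r : ℝ} (hr : 0 < r) :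
    Tendsto (fun ε => (multivariateGaussian (w ε) (S ε)).real {z | r ≤ ‖√ε • z‖}) l (𝓝 0) := by
  have htr : Tendsto (fun ε => (S ε).trace) l (𝓝 S₀.trace) :=
    ((Continuous.matrix_trace continuous_id).tendsto S₀).comp hS₀
  have hε : Tendsto (fun ε : ℝ => ε) l (𝓝 0) := tendsto_id.mono_left (hl.trans nhdsWithin_le_nhds)
  have hlim : Tendsto (fun ε => (‖w ε‖ ^ 2 + (S ε).trace) / r ^ 2 * ε) l (𝓝 0) := by
    simpa using ((((hw.norm.pow 2).add htr).div_const (r ^ 2)).mul hε)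
  refine squeeze_zero' (Eventually.of_forall fun _ => measureReal_nonneg) ?_ hlim
  filter_upwards [hS, hl self_mem_nhdsWithin] with ε hSε hε
  have hε' : (0 : ℝ) < ε := hε
  have hs : 0 < √ε := Real.sqrt_pos.2 hε'
  have hset : {z : E d | r ≤ ‖√ε • z‖} = {z | r / √ε ≤ ‖z‖} := by
    ext z
    simp only [Set.mem_ofPred_eq, norm_smul, Real.norm_of_nonneg hs.le]
    rw [div_le_iff₀ hs, mul_comm]
  rw [hset]
  refine (multivariateGaussian_real_tail_le hSε _ (div_pos hr hs)).trans (le_of_eq ?_)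
  rw [div_pow, Real.sq_sqrt hε'.le]
  field_simp

/-- Without the cut-off the integral is the characteristic function of `multivariateGaussian (w ε)
(S ε)`, which is continuous in its parameters even at a degenerate covariance. The cut-off changes
it by at most a vanishing tail. -/
theorem tendsto_integral_localChar_same {l : Filter ℝ} (hl : l ≤ 𝓝[>] 0) (c : ℝ → E d)
    {w : ℝ → E d} {S : ℝ → Matrix (Fin d) (Fin d) ℝ} {w₀ : E d} {S₀ : Matrix (Fin d) (Fin d) ℝ}
    (hS : ∀ᶠ ε in l, (S ε).PosSemidef) (hw : Tendsto w l (𝓝 w₀)) (hS₀ : Tendsto S l (𝓝 S₀))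
    {r : ℝ} (hr : 0 < r) (t : E d) :
    Tendsto (fun ε => ∫ y, localChar (c ε) r √ε t y
      ∂(multivariateGaussian (c ε + √ε • w ε) (ε • S ε))) l
      (𝓝 (Complex.exp (inner ℝ t w₀ * Complex.I - quadForm S₀ t / 2))) := by
  have hchar : Tendsto (fun ε => charFun (multivariateGaussian (w ε) (S ε)) t) l
      (𝓝 (Complex.exp (inner ℝ t w₀ * Complex.I - quadForm S₀ t / 2))) := by
    have hq : Tendsto (fun ε => quadForm (S ε) t) l (𝓝 (quadForm S₀ t)) := by
      have hc : Continuous fun M : Matrix (Fin d) (Fin d) ℝ => quadForm M t := by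
        unfold quadForm
        fun_prop
      exact (hc.tendsto S₀).comp hS₀
    have hi : Tendsto (fun ε => inner ℝ t (w ε)) l (𝓝 (inner ℝ t w₀)) :=
      tendsto_const_nhds.inner hw
    have h1 : Tendsto (fun ε => Complex.exp (inner ℝ t (w ε) * Complex.I - quadForm (S ε) t / 2)) l
        (𝓝 (Complex.exp (inner ℝ t w₀ * Complex.I - quadForm S₀ t / 2))) := by
      refine (Complex.continuous_exp.tendsto _).comp ?_
      exact (((Complex.continuous_ofReal.tendsto _).comp hi).mul_const _).sub
        (((Complex.continuous_ofReal.tendsto _).comp hq).div_const _)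
    refine h1.congr' ?_
    filter_upwards [hS] with ε hSε
    rw [charFun_multivariateGaussian_eq hSε]
  have hdiff : Tendsto (fun ε => ∫ y, localChar (c ε) r √ε t y
      ∂(multivariateGaussian (c ε + √ε • w ε) (ε • S ε)) -
      charFun (multivariateGaussian (w ε) (S ε)) t) l (𝓝 0) := by
    refine squeeze_zero_norm' ?_ (tendsto_rescaled_tail hl hS hw hS₀ hr)
    filter_upwards [hS, hl self_mem_nhdsWithin] with ε hSε hε
    have hε' : (0 : ℝ) < ε := hε
    have hs : 0 < √ε := Real.sqrt_pos.2 hε'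
    have hm := stronglyMeasurable_localChar (c ε) r √ε t
    have hmap : Measurable fun z : E d => c ε + √ε • z := by fun_prop
    have hint1 : Integrable (fun z => localChar (c ε) r √ε t (c ε + √ε • z))
        (multivariateGaussian (w ε) (S ε)) :=
      Integrable.of_bound (hm.comp_measurable hmap).aestronglyMeasurable 1
        (Eventually.of_forall fun z => norm_localChar_le _ _ _ _ _)
    have hint2 : Integrable (fun z : E d => Complex.exp (inner ℝ z t * Complex.I))
        (multivariateGaussian (w ε) (S ε)) :=
      Integrable.of_bound (Continuous.aestronglyMeasurable (by fun_prop)) 1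
        (Eventually.of_forall fun z => norm_cexp_ofReal_mul_I_le _)
    have hval : ∀ z : E d, localChar (c ε) r √ε t (c ε + √ε • z) =
        {z : E d | ‖√ε • z‖ ≤ r}.indicator (fun z => Complex.exp (inner ℝ z t * Complex.I)) z := by
      intro z
      have hz : (√ε)⁻¹ • (c ε + √ε • z - c ε) = z := by
        rw [add_sub_cancel_left, smul_smul, inv_mul_cancel₀ hs.ne', one_smul]
      by_cases h : ‖√ε • z‖ ≤ r
      · have h' : c ε + √ε • z ∈ Metric.closedBall (c ε) r := by simpa [dist_eq_norm] using h
        rw [localChar, Set.indicator_of_mem h',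
          Set.indicator_of_mem (show z ∈ {z : E d | ‖√ε • z‖ ≤ r} from h), hz]
      · have h' : c ε + √ε • z ∉ Metric.closedBall (c ε) r := by simpa [dist_eq_norm] using h
        rw [localChar, Set.indicator_of_notMem h',
          Set.indicator_of_notMem (show z ∉ {z : E d | ‖√ε • z‖ ≤ r} from h)]
    rw [multivariateGaussian_eq_map_rescaled hSε _ _ hε'.le,
      integral_map hmap.aemeasurable hm.aestronglyMeasurable, charFun_apply,
      ← integral_sub hint1 hint2]
    refine norm_integral_le_measureReal
      (measurableSet_le measurable_const (by fun_prop)) (fun z => ?_) fun z hz => ?_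
    · rw [hval]
      by_cases h : z ∈ {z : E d | ‖√ε • z‖ ≤ r}
      · rw [Set.indicator_of_mem h, sub_self]
        simp
      · rw [Set.indicator_of_notMem h, zero_sub, norm_neg]
        exact norm_cexp_ofReal_mul_I_le _
    · have hz' : ‖√ε • z‖ < r := not_le.1 hz
      have h : z ∈ {z : E d | ‖√ε • z‖ ≤ r} := hz'.le
      rw [hval, Set.indicator_of_mem h, sub_self]
  simpa using hdiff.add hchar

/-- A point within r of c is at distance at least r from c', because the centres are 2r apart. Only
the tail of the Gaussian around c' can contribute. -/
theorem tendsto_integral_localChar_other {l : Filter ℝ} (hl : l ≤ 𝓝[>] 0) {c c' : ℝ → E d}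
    {w : ℝ → E d} {S : ℝ → Matrix (Fin d) (Fin d) ℝ} {w₀ : E d} {S₀ : Matrix (Fin d) (Fin d) ℝ}
    (hS : ∀ᶠ ε in l, (S ε).PosSemidef) (hw : Tendsto w l (𝓝 w₀)) (hS₀ : Tendsto S l (𝓝 S₀))
    {r : ℝ} (hr : 0 < r) (hcc : ∀ᶠ ε in l, 2 * r ≤ ‖c ε - c' ε‖) (t : E d) :
    Tendsto (fun ε => ∫ y, localChar (c ε) r √ε t y
      ∂(multivariateGaussian (c' ε + √ε • w ε) (ε • S ε))) l (𝓝 0) := by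
  refine squeeze_zero_norm' ?_ (tendsto_rescaled_tail hl hS hw hS₀ hr)
  filter_upwards [hS, hcc, hl self_mem_nhdsWithin] with ε hSε hcε hε
  have hε' : (0 : ℝ) < ε := hε
  rw [multivariateGaussian_eq_map_rescaled hSε _ _ hε'.le,
    integral_map (by fun_prop) (stronglyMeasurable_localChar _ _ _ _).aestronglyMeasurable]
  refine norm_integral_le_measureReal (measurableSet_le measurable_const (by fun_prop))
    (fun z => norm_localChar_le _ _ _ _ _) fun z hz => ?_
  have hz' : ‖√ε • z‖ < r := not_le.1 hz
  refine Set.indicator_of_notMem (fun hmem => ?_) _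
  rw [Metric.mem_closedBall, dist_eq_norm] at hmem
  have : ‖c ε - c' ε‖ ≤ ‖√ε • z‖ + ‖c' ε + √ε • z - c ε‖ := by
    rw [show c ε - c' ε = √ε • z - (c' ε + √ε • z - c ε) by abel]
    exact norm_sub_le _ _
  linarith

theorem integral_mixture_of_bounded {ε : ℝ} {p : Params n d} (hα : ∀ i, 0 ≤ p.1 i) {f : E d → ℂ}
    (hf : StronglyMeasurable f) (hf1 : ∀ y, ‖f y‖ ≤ 1) :
    ∫ y, f y ∂(mixture ε p) =
      ∑ i, (p.1 i : ℂ) * ∫ y, f y ∂(multivariateGaussian (p.2.1 i) (ε • p.2.2 i)) := by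
  have hi : ∀ i, Integrable f (ENNReal.ofReal (p.1 i) •
      multivariateGaussian (p.2.1 i) (ε • p.2.2 i)) := fun i =>
    (Integrable.of_bound hf.aestronglyMeasurable 1
      (Eventually.of_forall hf1)).smul_measure ENNReal.ofReal_ne_top
  rw [mixture, integral_finsetSum_measure fun i _ => hi i]
  refine Finset.sum_congr rfl fun i _ => ?_
  rw [integral_smul_measure, ENNReal.toReal_ofReal (hα i), Complex.real_smul]

/-- Asymptotics of a localised characteristic function of a concentrating mixture. -/
theorem tendsto_integral_localChar_mixture {l : Filter ℝ} (hl : l ≤ 𝓝[>] 0) {c : ℝ → Fin n → E d}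
    {p : ℝ → Params n d} (hp : ∀ᶠ ε in l, p ε ∈ domain n d) (hα : ∀ᶠ ε in l, ∀ i, 0 ≤ (p ε).1 i)
    {τ : Fin n → Fin n} {a : Fin n → ℝ} {w : Fin n → E d} {S : Fin n → Matrix (Fin d) (Fin d) ℝ}
    (ha : ∀ i, Tendsto (fun ε => (p ε).1 i) l (𝓝 (a i)))
    (hw : ∀ i, Tendsto (fun ε => (√ε)⁻¹ • ((p ε).2.1 i - c ε (τ i))) l (𝓝 (w i)))
    (hS : ∀ i, Tendsto (fun ε => (p ε).2.2 i) l (𝓝 (S i)))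
    {r : ℝ} (hr : 0 < r) (hc : ∀ᶠ ε in l, ∀ j k, j ≠ k → 2 * r ≤ ‖c ε j - c ε k‖)
    (j : Fin n) (t : E d) :
    Tendsto (fun ε => ∫ y, localChar (c ε j) r √ε t y ∂(mixture ε (p ε))) l
      (𝓝 (∑ i, (a i : ℂ) * if τ i = j then
        Complex.exp (inner ℝ t (w i) * Complex.I - quadForm (S i) t / 2) else 0)) := by
  have hterm : ∀ i, Tendsto (fun ε => ((p ε).1 i : ℂ) * ∫ y, localChar (c ε j) r √ε t y
      ∂(multivariateGaussian ((p ε).2.1 i) (ε • (p ε).2.2 i))) l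
      (𝓝 ((a i : ℂ) * if τ i = j then
        Complex.exp (inner ℝ t (w i) * Complex.I - quadForm (S i) t / 2) else 0)) := by
    intro i
    refine ((Complex.continuous_ofReal.tendsto _).comp (ha i)).mul ?_
    have hmean : ∀ᶠ ε in l, (p ε).2.1 i =
        c ε (τ i) + √ε • ((√ε)⁻¹ • ((p ε).2.1 i - c ε (τ i))) := by
      filter_upwards [hl self_mem_nhdsWithin] with ε hε
      have hs : 0 < √ε := Real.sqrt_pos.2 hε
      rw [smul_smul, mul_inv_cancel₀ hs.ne', one_smul, add_sub_cancel]
    by_cases hij : τ i = j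
    · rw [if_pos hij]
      refine (tendsto_integral_localChar_same hl (fun ε => c ε j) (hp.mono fun ε h => h i) (hw i)
        (hS i) hr t).congr' ?_
      filter_upwards [hmean] with ε hε
      rw [← hij, ← hε]
    · rw [if_neg hij]
      refine (tendsto_integral_localChar_other hl (c := fun ε => c ε j) (c' := fun ε => c ε (τ i))
        (hp.mono fun ε h => h i) (hw i) (hS i) hr
        (hc.mono fun ε h => h j (τ i) (Ne.symm hij)) t).congr' ?_
      filter_upwards [hmean] with ε hε
      rw [← hε]
  refine (tendsto_finsetSum Finset.univ fun i _ => hterm i).congr' ?_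
  filter_upwards [hα] with ε hε
  rw [integral_mixture_of_bounded hε (stronglyMeasurable_localChar _ _ _ _)
    (norm_localChar_le _ _ _ _)]

theorem mixture_real_apply {ε : ℝ} {p : Params n d} (hα : ∀ i, 0 ≤ p.1 i) (A : Set (E d)) :
    (mixture ε p).real A =
      ∑ i, p.1 i * (multivariateGaussian (p.2.1 i) (ε • p.2.2 i)).real A := by
  simp only [Measure.real, mixture, Measure.coe_finsetSum, Measure.coe_smul, Finset.sum_apply,
    Pi.smul_apply, smul_eq_mul]
  rw [ENNReal.toReal_sum fun i _ => ENNReal.mul_ne_top ENNReal.ofReal_ne_top (measure_ne_top _ _)]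
  refine Finset.sum_congr rfl fun i _ => ?_
  rw [ENNReal.toReal_mul, ENNReal.toReal_ofReal (hα i)]

end GaussMix

/-! ### Compactness and identification of the limiting parameters -/

namespace GaussMix

open ProbabilityTheory Matrix

variable {d n : ℕ}

theorem exists_tendsto_ultrafilter_of_norm_le {ι F : Type*} [NormedAddCommGroup F] [ProperSpace F]
    (U : Ultrafilter ι) {f : ι → F} {B : ℝ} (h : ∀ᶠ i in (U : Filter ι), ‖f i‖ ≤ B) :
    ∃ a, Tendsto f U (𝓝 a) := by
  obtain ⟨a, -, ha⟩ := (isCompact_closedBall (0 : F) B).ultrafilter_le_nhds (U.map f) (by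
    rw [le_principal_iff]
    change ∀ᶠ i in (U : Filter ι), f i ∈ Metric.closedBall 0 B
    simpa using h)
  exact ⟨a, ha⟩

theorem multivariateGaussian_real_closedBall {S : Matrix (Fin d) (Fin d) ℝ} (hS : S.PosSemidef)
    (m c : E d) {ε : ℝ} (hε : 0 < ε) (R : ℝ) :
    (multivariateGaussian m (ε • S)).real (Metric.closedBall c (R * √ε)) =
      (multivariateGaussian ((√ε)⁻¹ • (m - c)) S).real (Metric.closedBall 0 R) := by
  have hs : 0 < √ε := Real.sqrt_pos.2 hε
  have hm : m = c + √ε • ((√ε)⁻¹ • (m - c)) := by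
    rw [smul_smul, mul_inv_cancel₀ hs.ne', one_smul, add_sub_cancel]
  conv_lhs => rw [hm]
  rw [multivariateGaussian_eq_map_rescaled hS _ _ hε.le,
    map_measureReal_apply (by fun_prop) Metric.isClosed_closedBall.measurableSet]
  congr 1
  ext z
  simp only [Set.mem_preimage, Metric.mem_closedBall, dist_eq_norm, add_sub_cancel_left, sub_zero,
    norm_smul, Real.norm_of_nonneg hs.le]
  rw [mul_comm, mul_le_mul_iff_left₀ hs]

/-- A mixture that puts little mass far away from the points `c j` has components that each put
substantial mass near one of these points. -/
theorem exists_mass_near {p : Params n d} {ε ξ : ℝ} (hn : 0 < n) (hξ : 0 < ξ)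
    (hp : ∀ i, ξ ≤ p.1 i) (c : Fin n → E d) {ρ : ℝ}
    (hmass : (mixture ε p).real {y | ∀ j, ρ ≤ ‖y - c j‖} ≤ ξ / 2) (i : Fin n) :
    ∃ j, 1 / (2 * n : ℝ) ≤
      (multivariateGaussian (p.2.1 i) (ε • p.2.2 i)).real (Metric.closedBall (c j) ρ) := by
  set N := multivariateGaussian (p.2.1 i) (ε • p.2.2 i) with hN
  set T := {y : E d | ∀ j, ρ ≤ ‖y - c j‖} with hT
  have hTm : MeasurableSet T := by
    have : T = ⋂ j, {y | ρ ≤ ‖y - c j‖} := by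
      ext y
      simp [hT]
    rw [this]
    exact MeasurableSet.iInter fun j => measurableSet_le measurable_const (by fun_prop)
  have hα : ∀ i, 0 ≤ p.1 i := fun i => hξ.le.trans (hp i)
  -- The component carries weight at least ξ, while the whole mixture gives `T` mass at most ξ/2.
  have h1 : N.real T ≤ 1 / 2 := by
    rw [mixture_real_apply hα] at hmass
    have h2 := Finset.single_le_sum (f := fun i =>
      p.1 i * (multivariateGaussian (p.2.1 i) (ε • p.2.2 i)).real T)
      (fun i _ => mul_nonneg (hα i) measureReal_nonneg) (Finset.mem_univ i)
    have h3 : ξ * N.real T ≤ p.1 i * N.real T :=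
      mul_le_mul_of_nonneg_right (hp i) measureReal_nonneg
    have h4 : ξ * N.real T ≤ ξ / 2 := h3.trans (h2.trans hmass)
    nlinarith
  have h2 : 1 / 2 ≤ N.real Tᶜ := by
    rw [probReal_compl_eq_one_sub hTm]
    linarith
  have h3 : Tᶜ ⊆ ⋃ j, Metric.closedBall (c j) ρ := by
    intro y hy
    have hy' : ¬ ∀ j, ρ ≤ ‖y - c j‖ := hy
    push Not at hy'
    obtain ⟨j, hj⟩ := hy'
    exact Set.mem_iUnion.2 ⟨j, by simpa [dist_eq_norm] using hj.le⟩
  have h4 : 1 / 2 ≤ ∑ j, N.real (Metric.closedBall (c j) ρ) :=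
    (h2.trans (measureReal_mono h3)).trans (measureReal_iUnion_fintype_le _)
  by_contra! hcon
  have hlt : ∑ j, N.real (Metric.closedBall (c j) ρ) < ∑ _j : Fin n, 1 / (2 * n : ℝ) :=
    Finset.sum_lt_sum_of_nonempty ⟨⟨0, hn⟩, Finset.mem_univ _⟩ fun j _ => hcon j
  have hn' : (0 : ℝ) < n := by exact_mod_cast hn
  simp only [Finset.sum_const, Finset.card_univ, Fintype.card_fin, nsmul_eq_mul] at hlt
  have : (n : ℝ) * (1 / (2 * n)) = 1 / 2 := by field_simp
  linarith

namespace Assumptions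

variable {V1e : ℝ → E d → ℝ} {V1 V2 : E d → ℝ} {xe : ℝ → Fin n → E d} {x : Fin n → E d}

theorem mixture_recovery_tail_le (hV : Assumptions V1e V1 V2 xe x) {ε R : ℝ} (hε : 0 < ε)
    (hR : 0 < R) :
    (mixture ε (recovery V1 V2 x xe ε)).real {y | ∀ j, R * √ε ≤ ‖y - xe ε j‖} ≤
      (∑ j, ((hessian V1 (x j))⁻¹).trace) / R ^ 2 := by
  have hs : 0 < √ε := Real.sqrt_pos.2 hε
  rw [mixture_real_apply fun i => (hV.weight_pos i).le, Finset.sum_div]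
  refine Finset.sum_le_sum fun j _ => ?_
  have hA : ((hessian V1 (x j))⁻¹).PosSemidef := (hV.hessian_posDef j).inv.posSemidef
  have hw1 : weight V1 V2 x j ≤ 1 := by
    rw [← hV.weight_mem_stdSimplex.2]
    exact Finset.single_le_sum (f := weight V1 V2 x) (fun i _ => (hV.weight_pos i).le)
      (Finset.mem_univ j)
  refine (mul_le_of_le_one_left measureReal_nonneg hw1).trans ?_
  have h := multivariateGaussian_real_tail_le hA 0 hR
  rw [norm_zero, zero_pow two_ne_zero, zero_add] at h
  refine le_trans ?_ h
  change (multivariateGaussian (xe ε j) (ε • (hessian V1 (x j))⁻¹)).real _ ≤ _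
  rw [multivariateGaussian_smul_eq_map hA _ hε.le]
  have hsub : {y : E d | ∀ j, R * √ε ≤ ‖y - xe ε j‖} ⊆ {y | R * √ε ≤ ‖y - xe ε j‖} :=
    fun y hy => hy j
  refine (measureReal_mono hsub).trans (le_of_eq ?_)
  rw [map_measureReal_apply (by fun_prop) (measurableSet_le measurable_const (by fun_prop))]
  congr 1
  ext z
  simp only [Set.mem_preimage, Set.mem_ofPred_eq, add_sub_cancel_left, norm_smul,
    Real.norm_of_nonneg hs.le]
  rw [mul_comm, mul_le_mul_iff_right₀ hs]

/-- Along an ultrafilter, mixtures that approximate the target have converging parameters. -/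
theorem exists_perm_tendsto (hV : Assumptions V1e V1 V2 xe x) {ξ₁ ξ₂ : ℝ} (hξ₁ : 0 < ξ₁)
    (hξ₂ : 0 < ξ₂) (hξ₂_le : ∀ᶠ ε in 𝓝[>] (0 : ℝ), ∀ i j, i ≠ j → ξ₂ ≤ ‖xe ε i - xe ε j‖)
    {u : ℝ → Params n d} {U : Ultrafilter ℝ} (hU : (U : Filter ℝ) ≤ 𝓝[>] 0)
    (hdom : ∀ᶠ ε in (U : Filter ℝ), u ε ∈ domain n d)
    (hadm : ∀ᶠ ε in (U : Filter ℝ), ((u ε).1, (u ε).2.1) ∈ admissible n d ξ₁ ξ₂)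
    (hkl : Tendsto (fun ε => InformationTheory.klDiv (mixture ε (u ε)) (target ε (V1e ε) V2)) U
      (𝓝 0)) :
    ∃ σ : Equiv.Perm (Fin n),
      Tendsto (fun ε => relabel σ (u ε)) U (𝓝 (limitParams V1 V2 x)) := by
  -- Both mixtures merge with the target, hence with each other. The value space is left free: real
  -- indicators give tightness, complex characters the identification.
  have hdiff : ∀ (F : Type) [NormedAddCommGroup F] [NormedSpace ℝ F] (f : ℝ → E d → F),
      (∀ ε, StronglyMeasurable (f ε)) → (∀ ε y, ‖f ε y‖ ≤ 1) →
      Tendsto (fun ε => ∫ y, f ε y ∂(mixture ε (u ε)) -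
        ∫ y, f ε y ∂(mixture ε (recovery V1 V2 x xe ε))) U (𝓝 0) := by
    intro F _ _ f hf hf1
    have hT := hU hV.isProbabilityMeasure_target
    have h1 := tendsto_integral_sub_of_klDiv
      (hadm.mono fun ε h => isProbabilityMeasure_mixture (ε := ε) h.1) hT hkl hf hf1
    have h2 := tendsto_integral_sub_of_klDiv
      (Eventually.of_forall fun ε => isProbabilityMeasure_mixture (ε := ε)
        (p := recovery V1 V2 x xe ε) hV.weight_mem_stdSimplex) hT
      (hV.tendsto_klDiv_recovery.mono_left hU) hf hf1
    simpa using h1.sub h2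
  have hα : ∀ᶠ ε in (U : Filter ℝ), ∀ i, 0 ≤ (u ε).1 i := hadm.mono fun ε h => h.1.1
  have hpos : ∀ᶠ ε in (U : Filter ℝ), 0 < ε := hU self_mem_nhdsWithin
  -- every component stays close to one of the minimisers
  obtain ⟨R, hR, hnear⟩ : ∃ R > 0, ∀ i, ∃ j, ∀ᶠ ε in (U : Filter ℝ), 1 / (2 * n : ℝ) ≤
      (multivariateGaussian ((u ε).2.1 i) (ε • (u ε).2.2 i)).real
        (Metric.closedBall (xe ε j) (R * √ε)) := by
    set K := ∑ j, ((hessian V1 (x j))⁻¹).trace with hK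
    have hK0 : 0 ≤ K := Finset.sum_nonneg fun j _ =>
      (hV.hessian_posDef j).inv.posSemidef.trace_nonneg
    have hR0 : 0 < √(4 * (K + 1) / ξ₁) := Real.sqrt_pos.2 (by positivity)
    -- With this radius the recovery mixture has mass at most ξ₁/4 outside the balls; the total
    -- variation error adds less than ξ₁/4, and the sum meets the threshold of `exists_mass_near`.
    refine ⟨√(4 * (K + 1) / ξ₁), hR0, fun i => ?_⟩
    set R := √(4 * (K + 1) / ξ₁) with hR
    -- An ultrafilter decides among finitely many alternatives, so the minimiser attracting
    -- component `i` can be chosen independently of ε.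
    rw [← Ultrafilter.eventually_exists_iff]
    set T : ℝ → Set (E d) := fun ε => {y | ∀ j, R * √ε ≤ ‖y - xe ε j‖} with hT
    have hTm : ∀ ε, MeasurableSet (T ε) := by
      intro ε
      have : T ε = ⋂ j, {y | R * √ε ≤ ‖y - xe ε j‖} := by
        ext y
        simp [hT]
      rw [this]
      exact MeasurableSet.iInter fun j => measurableSet_le measurable_const (by fun_prop)
    have h1 := hdiff ℝ (fun ε => (T ε).indicator 1)
      (fun ε => stronglyMeasurable_one.indicator (hTm ε)) fun ε y => by
        by_cases hy : y ∈ T ε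
        · simp [Set.indicator_of_mem hy]
        · simp [Set.indicator_of_notMem hy]
    simp only [integral_indicator_one (hTm _)] at h1
    filter_upwards [h1.eventually_lt_const (show 0 < ξ₁ / 4 by positivity), hpos, hadm]
      with ε hε hε0 had
    have h2 := hV.mixture_recovery_tail_le hε0 hR0
    have h3 : K / R ^ 2 ≤ ξ₁ / 4 := by
      rw [hR, Real.sq_sqrt (by positivity), div_div_eq_mul_div, div_le_div_iff₀ (by positivity)
        (by positivity)]
      nlinarith
    refine exists_mass_near hV.n_pos hξ₁ had.2.1 (xe ε) ?_ i
    change (mixture ε (u ε)).real (T ε) ≤ ξ₁ / 2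
    change (mixture ε (recovery V1 V2 x xe ε)).real (T ε) ≤ K / R ^ 2 at h2
    linarith
  choose τ hτ using hnear
  have hn : (0 : ℝ) < n := by exact_mod_cast hV.n_pos
  -- compactness of the rescaled parameters
  set b := (2 * R / (1 / (2 * n : ℝ))) ^ 2 with hb
  have hbound : ∀ i, ∀ᶠ ε in (U : Filter ℝ), ∀ k, (u ε).2.2 i k k ≤ b ∧
      |((√ε)⁻¹ • ((u ε).2.1 i - xe ε (τ i))) k| ≤ R + √(b / (1 / (2 * n : ℝ))) := by
    intro i
    filter_upwards [hτ i, hdom, hpos] with ε hε hd hε0 k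
    rw [multivariateGaussian_real_closedBall (hd i) _ _ hε0] at hε
    exact multivariateGaussian_bounds (hd i) hR (by positivity) hε k
  have hw : ∀ i, ∃ w, Tendsto (fun ε => (√ε)⁻¹ • ((u ε).2.1 i - xe ε (τ i))) U (𝓝 w) := by
    intro i
    refine exists_tendsto_ultrafilter_of_norm_le U
      (B := √(∑ _k : Fin d, (R + √(b / (1 / (2 * n : ℝ)))) ^ 2)) ?_
    filter_upwards [hbound i] with ε hε
    rw [EuclideanSpace.norm_eq]
    refine Real.sqrt_le_sqrt (Finset.sum_le_sum fun k _ => ?_)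
    exact pow_le_pow_left₀ (norm_nonneg _) (hε k).2 2
  have hS : ∀ i, ∃ S, Tendsto (fun ε => (u ε).2.2 i) U (𝓝 S) := by
    intro i
    have h : ∀ k l, ∃ s : ℝ, Tendsto (fun ε => (u ε).2.2 i k l) U (𝓝 s) := by
      intro k l
      refine exists_tendsto_ultrafilter_of_norm_le U (B := b) ?_
      filter_upwards [hbound i, hdom] with ε hε hd
      exact abs_apply_le_of_posSemidef (hd i) (fun k => (hε k).1) k l
    choose S hS using h
    exact ⟨S, tendsto_pi_nhds.2 fun k => tendsto_pi_nhds.2 fun l => hS k l⟩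
  have ha : ∀ i, ∃ a : ℝ, Tendsto (fun ε => (u ε).1 i) U (𝓝 a) := by
    intro i
    refine exists_tendsto_ultrafilter_of_norm_le U (B := 1) ?_
    filter_upwards [hadm] with ε had
    rw [Real.norm_of_nonneg (had.1.1 i), ← had.1.2]
    exact Finset.single_le_sum (f := (u ε).1) (fun i _ => had.1.1 i) (Finset.mem_univ i)
  choose w hw using hw
  choose S hS using hS
  choose a ha using ha
  have hm : ∀ i, Tendsto (fun ε => (u ε).2.1 i) U (𝓝 (x (τ i))) := by
    intro i
    have hs : Tendsto (fun ε : ℝ => √ε) U (𝓝 0) := by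
      have := Real.continuous_sqrt.tendsto 0
      rw [Real.sqrt_zero] at this
      exact this.mono_left (hU.trans nhdsWithin_le_nhds)
    have h1 := ((hV.minimisers_tendsto (τ i)).mono_left hU).add (hs.smul (hw i))
    rw [zero_smul, add_zero] at h1
    refine h1.congr' ?_
    filter_upwards [hpos] with ε hε
    rw [smul_smul, mul_inv_cancel₀ (Real.sqrt_pos.2 hε).ne', one_smul, add_sub_cancel]
  -- distinct components are attracted by distinct minimisers
  have hinj : Function.Injective τ := by
    intro i k hik
    by_contra hne
    have h1 := ((hm i).sub (hm k)).norm
    rw [hik, sub_self, norm_zero] at h1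
    have h2 := ge_of_tendsto h1 (hadm.mono fun ε h => h.2.2 i k hne)
    linarith
  set e := Equiv.ofBijective τ (Finite.injective_iff_bijective.1 hinj) with he
  have hsep : ∀ᶠ ε in (U : Filter ℝ), ∀ j k, j ≠ k → 2 * (ξ₂ / 2) ≤ ‖xe ε j - xe ε k‖ := by
    filter_upwards [hU hξ₂_le] with ε hε j k hjk
    linarith [hε j k hjk]
  -- the characteristic functions of the rescaled components agree in the limit
  have hchar : ∀ i t, (a i : ℂ) *
      Complex.exp (inner ℝ t (w i) * Complex.I - quadForm (S i) t / 2) =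
      (weight V1 V2 x (τ i) : ℂ) *
        Complex.exp (inner ℝ t 0 * Complex.I - quadForm (hessian V1 (x (τ i)))⁻¹ t / 2) := by
    intro i t
    have h1 := tendsto_integral_localChar_mixture hU hdom hα ha hw hS (half_pos hξ₂) hsep (τ i) t
    have h2 := tendsto_integral_localChar_mixture (p := fun ε => recovery V1 V2 x xe ε) (τ := id)
      (w := fun _ => 0) hU
      (Eventually.of_forall hV.recovery_mem_domain)
      (Eventually.of_forall fun _ i => (hV.weight_pos i).le)
      (fun i => tendsto_const_nhds) (fun i => by simp [recovery]) (fun i => tendsto_const_nhds)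
      (half_pos hξ₂) hsep (τ i) t
    have h3 := hdiff ℂ (fun ε => localChar (xe ε (τ i)) (ξ₂ / 2) √ε t)
      (fun ε => stronglyMeasurable_localChar _ _ _ _) (fun ε y => norm_localChar_le _ _ _ _ _)
    have h4 := tendsto_nhds_unique h3 (h1.sub h2)
    simp only [hinj.eq_iff, id, mul_ite, mul_zero, Finset.sum_ite_eq', Finset.mem_univ,
      if_true] at h4
    exact (sub_eq_zero.1 h4.symm)
  have ha0 : ∀ i, 0 ≤ a i := fun i => ge_of_tendsto (ha i) (hα.mono fun ε h => h i)
  -- Taking moduli removes the phase and with it the limit `w i` of the rescaled means, which is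
  -- irrelevant here: its boundedness already forces the means to converge.
  have hmod : ∀ i t, a i * Real.exp (-(quadForm (S i) t / 2)) =
      weight V1 V2 x (τ i) * Real.exp (-(quadForm (hessian V1 (x (τ i)))⁻¹ t / 2)) := by
    intro i t
    have h := congrArg norm (hchar i t)
    simpa [Complex.norm_exp, abs_of_nonneg (ha0 i), abs_of_pos (hV.weight_pos (τ i))] using h
  have haeq : ∀ i, a i = weight V1 V2 x (τ i) := by
    intro i
    simpa [quadForm] using hmod i 0
  have hSeq : ∀ i, S i = (hessian V1 (x (τ i)))⁻¹ := by
    intro i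
    -- Symmetry survives the limit and is what allows recovering `S i` from its quadratic form.
    have hherm : (S i).IsHermitian := by
      ext k l
      have h1 : Tendsto (fun ε => (u ε).2.2 i l k) U (𝓝 (S i l k)) :=
        tendsto_pi_nhds.1 (tendsto_pi_nhds.1 (hS i) l) k
      have h2 : Tendsto (fun ε => (u ε).2.2 i k l) U (𝓝 (S i k l)) :=
        tendsto_pi_nhds.1 (tendsto_pi_nhds.1 (hS i) k) l
      refine tendsto_nhds_unique (h1.congr' ?_) h2
      filter_upwards [hdom] with ε hd
      simpa using (hd i).isHermitian.apply k l
    refine eq_of_quadForm_eq hherm (hV.hessian_posDef (τ i)).inv.isHermitian fun t => ?_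
    have h := hmod i t
    rw [haeq i, mul_right_inj' (hV.weight_pos (τ i)).ne', Real.exp_eq_exp] at h
    linarith
  have hee : ∀ j, τ (e.symm j) = j := fun j => e.apply_symm_apply j
  -- Position `j` must receive the component attracted by `x j`, whence the inverse of `τ`.
  refine ⟨e.symm, ?_⟩
  refine Tendsto.prodMk_nhds ?_ (Tendsto.prodMk_nhds ?_ ?_)
  · refine tendsto_pi_nhds.2 fun j => ?_
    have := ha (e.symm j)
    rwa [haeq, hee] at this
  · refine tendsto_pi_nhds.2 fun j => ?_
    have := hm (e.symm j)
    rwa [hee] at this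
  · refine tendsto_pi_nhds.2 fun j => ?_
    have := hS (e.symm j)
    rwa [hSeq, hee] at this

theorem le_norm_sub (hV : Assumptions V1e V1 V2 xe x) {ξ₂ : ℝ}
    (hξ₂_le : ∀ᶠ ε in 𝓝[>] (0 : ℝ), ∀ i j, i ≠ j → ξ₂ ≤ ‖xe ε i - xe ε j‖) {i j : Fin n}
    (hij : i ≠ j) : ξ₂ ≤ ‖x i - x j‖ :=
  ge_of_tendsto ((hV.minimisers_tendsto i).sub (hV.minimisers_tendsto j)).norm
    (hξ₂_le.mono fun _ h => h i j hij)

/-- Every divergence involved is that of a measure from itself. Admissibility of the limiting means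
follows by passing to the limit in the separation of the `xe ε i`. -/
theorem Glim_limitParams (hV : Assumptions V1e V1 V2 xe x) {ξ₁ ξ₂ : ℝ}
    (hξ₁_le : ∀ i, ξ₁ ≤ weight V1 V2 x i)
    (hξ₂_le : ∀ᶠ ε in 𝓝[>] (0 : ℝ), ∀ i j, i ≠ j → ξ₂ ≤ ‖xe ε i - xe ε j‖) :
    Glim ξ₁ ξ₂ V1 V2 x (limitParams V1 V2 x) = 0 := by
  have hfin : IsFiniteMeasure (discreteMeasure (weight V1 V2 x)) := by
    refine ⟨?_⟩
    simp [discreteMeasure, ENNReal.sum_lt_top]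
  have h : ((limitParams V1 V2 x).1, (limitParams V1 V2 x).2.1) ∈ admissible n d ξ₁ ξ₂ ∧
      ∀ i, (limitParams V1 V2 x).2.1 i ∈ Set.range x :=
    ⟨⟨hV.weight_mem_stdSimplex, hξ₁_le, fun i j hij => hV.le_norm_sub hξ₂_le hij⟩,
      fun i => Set.mem_range_self i⟩
  rw [Glim, if_pos h]
  simp [limitParams, InformationTheory.klDiv_self]

end Assumptions

end GaussMix

/-! ### Convergence of the minimisers and of the minimal values -/

theorem corollary4p3 {d n : ℕ} (V1e : ℝ → GaussMix.E d → ℝ) (V1 V2 : GaussMix.E d → ℝ)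
    (xe : ℝ → Fin n → GaussMix.E d) (x : Fin n → GaussMix.E d)
    (hV : GaussMix.Assumptions V1e V1 V2 xe x)
    (ξ₁ ξ₂ : ℝ) (hξ₁ : 0 < ξ₁) (hξ₁_le : ∀ i, ξ₁ ≤ GaussMix.weight V1 V2 x i)
    (hξ₂ : 0 < ξ₂)
    (hξ₂_le : ∀ᶠ ε in 𝓝[>] (0 : ℝ), ∀ i j, i ≠ j → ξ₂ ≤ ‖xe ε i - xe ε j‖)
    (u : ℝ → GaussMix.Params n d)
    (hu : ∀ᶠ ε in 𝓝[>] (0 : ℝ),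
      GaussMix.IsMinimiser (GaussMix.Geps ξ₁ ξ₂ ε (V1e ε) V2) (u ε)) :
    (∀ e : ℕ → ℝ, Tendsto e atTop (𝓝[>] 0) →
      ∃ φ : ℕ → ℕ, StrictMono φ ∧ ∃ σ : Equiv.Perm (Fin n),
        Tendsto (fun k => GaussMix.relabel σ (u (e (φ k)))) atTop
          (𝓝 (GaussMix.limitParams V1 V2 x)) ∧
        Tendsto (fun k => GaussMix.Geps ξ₁ ξ₂ (e (φ k)) (V1e (e (φ k))) V2 (u (e (φ k)))) atTop
          (𝓝 (GaussMix.Glim ξ₁ ξ₂ V1 V2 x (GaussMix.limitParams V1 V2 x)))) ∧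
    GaussMix.IsMinimiser (GaussMix.Glim ξ₁ ξ₂ V1 V2 x) (GaussMix.limitParams V1 V2 x) ∧
    GaussMix.Glim ξ₁ ξ₂ V1 V2 x (GaussMix.limitParams V1 V2 x) = 0 ∧
    Tendsto (fun ε => GaussMix.Geps ξ₁ ξ₂ ε (V1e ε) V2 (u ε)) (𝓝[>] 0) (𝓝 0) := by
  have hG := hV.Glim_limitParams hξ₁_le hξ₂_le
  have hGeps : Tendsto (fun ε => GaussMix.Geps ξ₁ ξ₂ ε (V1e ε) V2 (u ε)) (𝓝[>] 0) (𝓝 0) := by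
    -- The recovery mixture is an admissible competitor for small ε, so its vanishing divergence
    -- bounds the minimal value.
    refine tendsto_of_tendsto_of_tendsto_of_le_of_le' tendsto_const_nhds
      hV.tendsto_klDiv_recovery (Eventually.of_forall fun _ => zero_le) ?_
    filter_upwards [hu, hξ₂_le] with ε hε hsep
    have h1 := hε.2 (hV.recovery_mem_domain ε)
    have h2 : ((GaussMix.Assumptions.recovery V1 V2 x xe ε).1,
        (GaussMix.Assumptions.recovery V1 V2 x xe ε).2.1) ∈ GaussMix.admissible n d ξ₁ ξ₂ :=
      ⟨hV.weight_mem_stdSimplex, hξ₁_le, hsep⟩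
    have h3 : GaussMix.Geps ξ₁ ξ₂ ε (V1e ε) V2 (u ε) ≤
        GaussMix.Geps ξ₁ ξ₂ ε (V1e ε) V2 (GaussMix.Assumptions.recovery V1 V2 x xe ε) := h1
    conv_rhs at h3 => rw [GaussMix.Geps, if_pos h2]
    exact h3
  have hadm : ∀ᶠ ε in 𝓝[>] (0 : ℝ),
      ((u ε).1, (u ε).2.1) ∈ GaussMix.admissible n d ξ₁ ξ₂ := by
    -- Values tending to 0 are eventually finite, which excludes the infinite branch of `Geps`.
    filter_upwards [hGeps.eventually_ne ENNReal.zero_ne_top] with ε hε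
    by_contra hcon
    exact hε (by rw [GaussMix.Geps, if_neg hcon])
  have hkl : Tendsto (fun ε => InformationTheory.klDiv (GaussMix.mixture ε (u ε))
      (GaussMix.target ε (V1e ε) V2)) (𝓝[>] 0) (𝓝 0) := by
    refine hGeps.congr' ?_
    filter_upwards [hadm] with ε hε
    rw [GaussMix.Geps, if_pos hε]
  refine ⟨fun e he => ?_, ⟨fun i => (hV.hessian_posDef i).inv.posSemidef, ?_⟩, hG, hGeps⟩
  -- The ultrafilter fixes a single permutation first. The limit along it is then a cluster point of
  -- the relabelled sequence, and first countability yields a subsequence for that same permutation.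
  · set U : Ultrafilter ℝ := (Ultrafilter.of (atTop : Filter ℕ)).map e with hU
    have hU' : (U : Filter ℝ) ≤ 𝓝[>] 0 := (map_mono (Ultrafilter.of_le _)).trans he
    obtain ⟨σ, hσ⟩ := hV.exists_perm_tendsto hξ₁ hξ₂ hξ₂_le hU'
      (hU' (hu.mono fun ε h => h.1)) (hU' hadm) (hkl.mono_left hU')
    have hσ' : Tendsto (fun k => GaussMix.relabel σ (u (e k))) (Ultrafilter.of (atTop : Filter ℕ))
        (𝓝 (GaussMix.limitParams V1 V2 x)) := hσ.comp tendsto_map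
    have hcl : MapClusterPt (GaussMix.limitParams V1 V2 x) atTop
        (fun k => GaussMix.relabel σ (u (e k))) :=
      hσ'.mapClusterPt.mono (Ultrafilter.of_le _)
    have : FirstCountableTopology (Matrix (Fin d) (Fin d) ℝ) :=
      inferInstanceAs (FirstCountableTopology (Fin d → Fin d → ℝ))
    have : FirstCountableTopology (GaussMix.Params n d) :=
      inferInstanceAs (FirstCountableTopology
        ((Fin n → ℝ) × (Fin n → GaussMix.E d) × (Fin n → Matrix (Fin d) (Fin d) ℝ)))
    obtain ⟨φ, hφ, hlim⟩ := hcl.tendsto_subseq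
    refine ⟨φ, hφ, σ, hlim, ?_⟩
    rw [hG]
    exact hGeps.comp (he.comp hφ.tendsto_atTop)
  · intro p _
    change GaussMix.Glim ξ₁ ξ₂ V1 V2 x (GaussMix.limitParams V1 V2 x) ≤ _
    rw [hG]
    exact zero_le
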